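/- Let $0<p<1$ and let $\{U_{\mathbf w}:\mathbf w\in\mathbb Z^2\}$ be i.i.d. uniform $(0,1)$ random variables on a probability space. A vertex $\mathbf w\in\mathbb Z^2$ is open if $U_{\mathbf w}<p$; $\mathscr V$ is the set of open vertices. For $\mathbf u\in\mathbb Z^2$ and $k\ge 1$ let $H(\mathbf u,k)=\{\mathbf w\in\mathbb Z^2:\mathbf w(2)=\mathbf u(2)+k,\ |\mathbf w(1)-\mathbf u(1)|\le k\}$ and, for $h\ge 0$, $V(\mathbf u,h)=\bigcup_{k=1}^h H(\mathbf u,k)$. The successor $\tilde{\mathbf u}$ of $\mathbf u$ is the (almost surely unique) open vertex such that for some $l\ge1$: $\tilde{\mathbf u}\in V(\mathbf u,l)$, $V(\mathbf u,l-1)\cap\mathscr V=\emptyset$, and $U_{\tilde{\mathbf u}}\le U_{\mathbf w}$ for all $\mathbf w\in H(\mathbf u,l)\cap\mathscr V$. For $\mathbf u,\mathbf v\in\mathbb Z^2$ with $\mathbf u(2)=\mathbf v(2)$ put $h_0(\mathbf u)=\mathbf u$, $h_0(\mathbf v)=\mathbf v$, $r_n=\min\{h_n(\mathbf u)(2),h_n(\mathbf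 v)(2)\}$ and, for $\mathbf x\in\{\mathbf u,\mathbf v\}$, let $h_{n+1}(\mathbf x)$ be the successor of $h_n(\mathbf x)$ if $h_n(\mathbf x)(2)=r_n$, and $h_{n+1}(\mathbf x)=h_n(\mathbf x)$ otherwise. Let $\tau_0=0$, $\tau_{l+1}=\inf\{n>\tau_l:h_n(\mathbf u)(2)=h_n(\mathbf v)(2)\}$, $Z_l=h_{\tau_l}(\mathbf u)(1)-h_{\tau_l}(\mathbf v)(1)$, $T_l=h_{\tau_l}(\mathbf u)(2)-\mathbf u(2)$ and $n_{\mathbf u,\mathbf v}=\inf\{n\ge1:Z_n=0\}$ (with $\inf\emptyset=\infty$ and $T_\infty=\infty$). Let $\pi_{\mathbf u}:[\mathbf u(2),\infty)\to\mathbb R$ be the path which is piecewise linear through the points $\mathbf u,\tilde{\mathbf u},\tilde{\tilde{\mathbf u}},\dots$ (abscissa as a function of height). For $n\ge1$ and $\sigma,\gamma>0$ let $\mathcal X_n(\sigma,\gamma)$ be the set of the scaled paths $t\mapsto\pi_{\mathbf u}(n^2\gamma t)/(n\sigma)$, $t\ge\mathbf u(2)/(n^2\gamma)$, with $\mathbf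 u\in\mathscr V$. Let $\mathbb R^2_c$ be the completion of $\mathbb R^2$ in the metric $\rho((x_1,t_1),(x_2,t_2))=|\tanh t_1-\tanh t_2|\vee\bigl|\frac{\tanh x_1}{1+|t_1|}-\frac{\tanh x_2}{1+|t_2|}\bigr|$, and let $\Pi$ be the set of paths $\pi:[\varsigma_\pi,\infty]\to[-\infty,\infty]\cup\{*\}$ with $\varsigma_\pi\in[-\infty,\infty]$, such that $t\mapsto(\pi(t),t)$ is continuous into $\mathbb R^2_c$ and $\pi$ has the value $*$ exactly at the times $\pm\infty$ of its domain, with the metric $$d_\Pi(\pi_1,\pi_2)=|\tanh\varsigma_{\pi_1}-\tanh\varsigma_{\pi_2}|\vee\sup_{t\ge\varsigma_{\pi_1}\wedge\varsigma_{\pi_2}}\Bigl|\frac{\tanh\pi_1(t\vee\varsigma_{\pi_1})}{1+|t|}-\frac{\tanh\pi_2(t\vee\varsigma_{\pi_2})}{1+|t|}\Bigr|,\qquad \tanh(*):=0.$$ Let $\bar{\mathcal X}_n(\sigma,\gamma)$ be the closure of $\mathcal X_n(\sigma,\gamma)$ in $(\Pi,d_\Pi)$. For $\Gamma\subseteq\Pi$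 let $\eta_\Gamma(t_0,t;a,b)=\#\{\pi(t_0+t):\pi\in\Gamma,\ \varsigma_\pi\le t_0,\ \pi(t_0)\in[a,b]\}$. **Proposition.** There are constants $C,C'>0$ depending only on $p$ such that, for every integer $x\ge1$ and every real $t>0$, with $\mathbf u=(x,0)$ and $\mathbf v=(0,0)$, $$\mathbb P\{n_{\mathbf u,\mathbf v}>t\}\le\frac{C\,x}{\sqrt t}\qquad\text{and}\qquad \mathbb P\{T_{n_{\mathbf u,\mathbf v}}(\mathbf u,\mathbf v)\ge t\}\le\frac{C'\,x}{\sqrt t}.$$ Moreover, for all $\sigma,\gamma>0$, the sequence $\bar{\mathcal X}_n(\sigma,\gamma)$ satisfies condition (B$_1$): for every $t>0$, $$\limsup_{n\to\infty}\ \sup_{(a,t_0)\in\mathbb R^2}\mathbb P\bigl\{\eta_{\bar{\mathcal X}_n(\sigma,\gamma)}(t_0,t;a,a+\varepsilon)\ge2\bigr\}\longrightarrow0\qquad\text{as }\varepsilon\downarrow0.$$ -/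

import Mathlib

open MeasureTheory ProbabilityTheory Filter Topology
open scoped ENNReal

namespace Drainage

noncomputable section

/-! ### The drainage graph on `ℤ²`

A configuration is a map `c : ℤ × ℤ → ℝ`; the point `w` has abscissa `w.1` and height `w.2`. -/

/-- The random field `U` is a family of i.i.d. uniform `(0,1)` random variables on `(Ω, P)`. -/
structure IsUniformField {Ω : Type*} [MeasurableSpace Ω] (P : Measure Ω)
    (U : ℤ × ℤ → Ω → ℝ) : Prop where
  measurable : ∀ w, Measurable (U w)
  law : ∀ w, P.map (U w) = (volume : Measure ℝ).restrict (Set.Ioo 0 1)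
  indep : iIndepFun U P

/-- The set of open vertices. -/
def openVertices (c : ℤ × ℤ → ℝ) (p : ℝ) : Set (ℤ × ℤ) := {w | c w < p}

/-- The level `H(u,k)` of the light cone above `u` (empty for `k = 0`). -/
def coneLevel (u : ℤ × ℤ) (k : ℕ) : Set (ℤ × ℤ) :=
  {w | 1 ≤ k ∧ w.2 = u.2 + (k : ℤ) ∧ |w.1 - u.1| ≤ (k : ℤ)}

/-- The truncated cone `V(u,h) = H(u,1) ∪ ⋯ ∪ H(u,h)`. -/
def cone (u : ℤ × ℤ) (h : ℕ) : Set (ℤ × ℤ) := ⋃ k ∈ Set.Icc 1 h, coneLevel u k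

/-- `w` is an admissible successor of `u`: for some `l + 1 ≥ 1`, it is an open vertex of
`V(u,l+1)`, there is no open vertex in `V(u,l)`, and `c w` is minimal among the open vertices
of `H(u,l+1)`. -/
def IsSuccessor (c : ℤ × ℤ → ℝ) (p : ℝ) (u w : ℤ × ℤ) : Prop :=
  w ∈ openVertices c p ∧ ∃ l : ℕ, w ∈ cone u (l + 1) ∧ cone u l ∩ openVertices c p = ∅ ∧
    ∀ z ∈ coneLevel u (l + 1) ∩ openVertices c p, c w ≤ c z

open Classical in
/-- The successor `ũ` of `u`. Almost surely there is exactly one admissible successor of every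
vertex; if there is none, the (irrelevant) value `u + (0,1)` is used. -/
def nextVertex (c : ℤ × ℤ → ℝ) (p : ℝ) (u : ℤ × ℤ) : ℤ × ℤ :=
  if h : ∃ w, IsSuccessor c p u w then h.choose else (u.1, u.2 + 1)

/-! ### The joint exploration of two paths and its regeneration times -/

/-- One step of the exploration from two vertices: those of the two which are at the minimal height
move to their successors, the other one (if any) stays. -/
def pairStep (c : ℤ × ℤ → ℝ) (p : ℝ) (a : (ℤ × ℤ) × (ℤ × ℤ)) : (ℤ × ℤ) × (ℤ × ℤ) :=
  (if a.1.2 = min a.1.2 a.2.2 then nextVertex c p a.1 else a.1,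
   if a.2.2 = min a.1.2 a.2.2 then nextVertex c p a.2 else a.2)

/-- `pairPos c p u v n = (h_n(u), h_n(v))`. -/
def pairPos (c : ℤ × ℤ → ℝ) (p : ℝ) (u v : ℤ × ℤ) (n : ℕ) : (ℤ × ℤ) × (ℤ × ℤ) :=
  (pairStep c p)^[n] (u, v)

/-- The number `τ_l` of exploration steps up to the `l`-th regeneration: `τ_0 = 0` and
`τ_{l+1} = inf {n > τ_l : h_n(u)(2) = h_n(v)(2)}`, with `inf ∅ = ∞`. -/
def regenStep (c : ℤ × ℤ → ℝ) (p : ℝ) (u v : ℤ × ℤ) : ℕ → ℕ∞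
  | 0 => 0
  | l + 1 => sInf {n : ℕ∞ | ∃ m : ℕ, n = (m : ℕ∞) ∧ regenStep c p u v l < (m : ℕ∞) ∧
      (pairPos c p u v m).1.2 = (pairPos c p u v m).2.2}

/-- The difference `Z_l = h_{τ_l}(u)(1) - h_{τ_l}(v)(1)` (meaningful when `τ_l < ∞`). -/
def regenDiff (c : ℤ × ℤ → ℝ) (p : ℝ) (u v : ℤ × ℤ) (l : ℕ) : ℤ :=
  (pairPos c p u v (regenStep c p u v l).toNat).1.1 -
    (pairPos c p u v (regenStep c p u v l).toNat).2.1

open Classical in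
/-- The regeneration height `T_l = h_{τ_l}(u)(2) - u(2)`, equal to `∞` if `τ_l = ∞`. -/
def regenHeight (c : ℤ × ℤ → ℝ) (p : ℝ) (u v : ℤ × ℤ) (l : ℕ) : EReal :=
  if regenStep c p u v l = ⊤ then ⊤
  else ((((pairPos c p u v (regenStep c p u v l).toNat).1.2 - u.2 : ℤ) : ℝ) : EReal)

/-- The number `n_{u,v} = inf {n ≥ 1 : Z_n = 0}` of regeneration steps until coalescence,
with `inf ∅ = ∞`. -/
def coalSteps (c : ℤ × ℤ → ℝ) (p : ℝ) (u v : ℤ × ℤ) : ℕ∞ :=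
  sInf {n : ℕ∞ | ∃ m : ℕ, n = (m : ℕ∞) ∧ 1 ≤ m ∧ regenStep c p u v m ≠ ⊤ ∧
    regenDiff c p u v m = 0}

open Classical in
/-- The height `T_{n_{u,v}}` of the coalescing regeneration, equal to `∞` if `n_{u,v} = ∞`. -/
def coalHeight (c : ℤ × ℤ → ℝ) (p : ℝ) (u v : ℤ × ℤ) : EReal :=
  if coalSteps c p u v = ⊤ then ⊤ else regenHeight c p u v (coalSteps c p u v).toNat

/-! ### The space of paths `(Π, d_Π)` -/

open Classical in
/-- The extension of `tanh` to `[-∞,∞]` by `tanh (±∞) = ±1`. -/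
def tanhE (x : EReal) : ℝ :=
  if x = ⊤ then 1 else if x = ⊥ then -1 else Real.tanh x.toReal

open Classical in
/-- The weight `1 / (1 + |t|)` for `t ∈ [-∞,∞]`, equal to `0` at `±∞`. -/
def weight (t : EReal) : ℝ :=
  if t = ⊤ ∨ t = ⊥ then 0 else 1 / (1 + |t.toReal|)

/-- `tanh` on `[-∞,∞] ∪ {∗}`; the extra point `∗` is `none`, where the value is `0` by convention. -/
def tanhStar : Option EReal → ℝ
  | none => 0
  | some x => tanhE x

/-- The embedding `(x,t) ↦ (tanh x / (1 + |t|), tanh t)` in `ℝ²`. The metric `ρ` of the space-time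
plane is the pullback of the sup metric of `ℝ × ℝ`, so that the completion `ℝ²_c` is identified with
a closed subset of `ℝ × ℝ`; the points with `t = ±∞` go to `(∗,±∞) = (0,±1)`. -/
def compactify (x : Option EReal) (t : EReal) : ℝ × ℝ := (tanhStar x * weight t, tanhE t)

/-- A path `π : [ς,∞] → [-∞,∞] ∪ {∗}` in `ℝ²_c` with starting time `ς ∈ [-∞,∞]`: it takes the value
`∗` exactly at the times `±∞` in its domain and `t ↦ (π(t),t)` is continuous into `ℝ²_c`.
The values of `toFun` at times before `start` are irrelevant. -/
structure WebPath where
  start : EReal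
  toFun : EReal → Option EReal
  eq_star_iff : ∀ t, start ≤ t → (toFun t = none ↔ t = ⊤ ∨ t = ⊥)
  continuousOn : ContinuousOn (fun t => compactify (toFun t) t) (Set.Icc start ⊤)

/-- The metric `d_Π`. -/
def pathDist (π₁ π₂ : WebPath) : ℝ :=
  max |tanhE π₁.start - tanhE π₂.start|
    (⨆ t : Set.Icc (min π₁.start π₂.start) (⊤ : EReal),
      |tanhStar (π₁.toFun (max t π₁.start)) * weight t -
        tanhStar (π₂.toFun (max t π₂.start)) * weight t|)

/-- The closure of a set of paths in `(Π, d_Π)`. -/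
def pathClosure (Γ : Set WebPath) : Set WebPath :=
  {π | ∀ ε : ℝ, 0 < ε → ∃ π' ∈ Γ, pathDist π π' < ε}

/-- `η_Γ(t₀,t;a,b)`: the number of distinct positions at time `t₀ + t` of the paths of `Γ` which
start at or before time `t₀` and lie in `[a,b]` at time `t₀`. -/
def eta (Γ : Set WebPath) (t₀ t a b : ℝ) : ℕ∞ :=
  Set.encard {y : Option EReal | ∃ π ∈ Γ, π.start ≤ (t₀ : EReal) ∧
    (∃ x ∈ Set.Icc a b, π.toFun (t₀ : EReal) = some (x : EReal)) ∧
    y = π.toFun ((t₀ + t : ℝ) : EReal)}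

/-- Condition (B₁) for a sequence `Θ` of random sets of paths: for every `t > 0`,
`limsup_n sup_{(a,t₀)} P(η_{Θ_n}(t₀,t;a,a+ε) ≥ 2) → 0` as `ε ↓ 0`. -/
def ConditionB1 {Ω : Type*} [MeasurableSpace Ω] (P : Measure Ω)
    (Θ : ℕ → Ω → Set WebPath) : Prop :=
  ∀ t : ℝ, 0 < t → Tendsto
    (fun ε : ℝ => limsup
      (fun n : ℕ => ⨆ q : ℝ × ℝ, P {ω | 2 ≤ eta (Θ n ω) q.2 t q.1 (q.1 + ε)}) atTop)
    (𝓝[>] 0) (𝓝 0)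

/-! ### The diffusively scaled paths of the graph -/

/-- The piecewise linear function through the points `a k`, `k ≥ 0` (abscissa as a function of
height): with `N = max {k : (a k).2 ≤ t}`, it is linear between the heights of `a N` and
`a (N + 1)`. -/
def polyline (a : ℕ → ℤ × ℤ) (t : ℝ) : ℝ :=
  let N : ℕ := sSup {k : ℕ | ((a k).2 : ℝ) ≤ t}
  ((a N).1 : ℝ) + (t - (a N).2) / ((a (N + 1)).2 - (a N).2) * ((a (N + 1)).1 - (a N).1)

/-- The vertices `u_0 = u`, `u_{k+1} = ũ_k`. -/
def orbit (c : ℤ × ℤ → ℝ) (p : ℝ) (u : ℤ × ℤ) (k : ℕ) : ℤ × ℤ := (nextVertex c p)^[k] u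

/-- The path `π_u` (used on `[u(2),∞)`). -/
def graphPath (c : ℤ × ℤ → ℝ) (p : ℝ) (u : ℤ × ℤ) (t : ℝ) : ℝ := polyline (orbit c p u) t

theorem height_lt_nextVertex (c : ℤ × ℤ → ℝ) (p : ℝ) (u : ℤ × ℤ) : u.2 < (nextVertex c p u).2 := by
  unfold nextVertex
  split_ifs with h
  · obtain ⟨-, l, hl, -⟩ := h.choose_spec
    simp only [cone, Set.mem_iUnion] at hl
    obtain ⟨k, -, hk1, hk2, -⟩ := hl
    omega
  · exact lt_add_one _

theorem strictMono_orbit (c : ℤ × ℤ → ℝ) (p : ℝ) (u : ℤ × ℤ) :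
    StrictMono fun k => (orbit c p u k).2 := by
  refine strictMono_nat_of_lt_succ fun k => ?_
  simp only [orbit, Function.iterate_succ_apply']
  exact height_lt_nextVertex c p _

theorem polyline_index {a : ℕ → ℤ × ℤ} (ha : StrictMono fun k => (a k).2) {t : ℝ} {k : ℕ}
    (h1 : k = 0 ∨ ((a k).2 : ℝ) ≤ t) (h2 : t < (a (k + 1)).2) :
    sSup {j : ℕ | ((a j).2 : ℝ) ≤ t} = k := by
  have hle : ∀ j : ℕ, ((a j).2 : ℝ) ≤ t → j ≤ k := by
    intro j hj
    have : ((a j).2 : ℝ) < (a (k + 1)).2 := lt_of_le_of_lt hj h2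
    have h3 : (a j).2 < (a (k + 1)).2 := by exact_mod_cast this
    have := ha.lt_iff_lt.1 h3
    omega
  by_cases hk : ((a k).2 : ℝ) ≤ t
  · exact le_antisymm (csSup_le ⟨k, hk⟩ hle) (le_csSup ⟨k, fun j hj => hle j hj⟩ hk)
  · have hk0 : k = 0 := h1.resolve_right hk
    subst hk0
    have : {j : ℕ | ((a j).2 : ℝ) ≤ t} = ∅ := by
      ext j
      simp only [Set.mem_ofPred_eq, Set.mem_empty_iff_false, iff_false]
      intro hj
      have h0 := hle j hj
      have : j = 0 := by omega
      subst this
      exact hk hj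
    rw [this]
    simp

theorem polyline_eq {a : ℕ → ℤ × ℤ} (ha : StrictMono fun k => (a k).2) {t : ℝ} {k : ℕ}
    (h1 : k = 0 ∨ ((a k).2 : ℝ) ≤ t) (h2 : t ≤ (a (k + 1)).2) :
    polyline a t =
      ((a k).1 : ℝ) + (t - (a k).2) / ((a (k + 1)).2 - (a k).2) * ((a (k + 1)).1 - (a k).1) := by
  have hlt : ∀ j : ℕ, ((a j).2 : ℝ) < (a (j + 1)).2 := fun j => by
    exact_mod_cast ha (Nat.lt_succ_self j)
  rcases lt_or_eq_of_le h2 with h | h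
  · simp only [polyline, polyline_index ha h1 h]
  · have hi : sSup {j : ℕ | ((a j).2 : ℝ) ≤ t} = k + 1 :=
      polyline_index ha (Or.inr h.ge) (h ▸ hlt (k + 1))
    have hne : ((a (k + 1)).2 : ℝ) - (a k).2 ≠ 0 := (sub_pos.2 (hlt k)).ne'
    simp only [polyline, hi]
    rw [h, sub_self, zero_div, zero_mul, add_zero, div_self hne, one_mul]
    ring

theorem continuous_polyline {a : ℕ → ℤ × ℤ} (ha : StrictMono fun k => (a k).2) :
    Continuous (polyline a) := by
  have hgrow : ∀ k : ℕ, (a 0).2 + k ≤ (a k).2 := by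
    intro k
    induction k with
    | zero => simp
    | succ k ih =>
      have : (a k).2 < (a (k + 1)).2 := ha (Nat.lt_succ_self k)
      push_cast
      omega
  let f : ℕ → Set ℝ := fun k => {t | (k = 0 ∨ ((a k).2 : ℝ) ≤ t) ∧ t ≤ (a (k + 1)).2}
  refine LocallyFinite.continuous (f := f) ?_ ?_ ?_ ?_
  · intro x
    refine ⟨Set.Iio (x + 1), Iio_mem_nhds (lt_add_one x), ?_⟩
    refine (Set.finite_Iic (⌈x + 1 - (a 0).2⌉₊)).subset ?_
    rintro k ⟨t, ⟨hk, -⟩, ht⟩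
    simp only [Set.mem_Iic]
    rcases hk with rfl | hk
    · exact Nat.zero_le _
    · have h1 : (((a 0).2 + k : ℤ) : ℝ) ≤ (a k).2 := by exact_mod_cast hgrow k
      push_cast at h1
      have h2 : t < x + 1 := ht
      have h3 : (k : ℝ) ≤ x + 1 - (a 0).2 := by linarith
      exact_mod_cast h3.trans (Nat.le_ceil _)
  · refine Set.eq_univ_of_forall fun t => ?_
    have hex : ∃ k : ℕ, t ≤ (a (k + 1)).2 := by
      refine ⟨⌈t - (a 0).2⌉₊, ?_⟩
      have h1 := hgrow (⌈t - (a 0).2⌉₊ + 1)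
      have h2 : (((a 0).2 + ((⌈t - (a 0).2⌉₊ + 1 : ℕ) : ℤ) : ℤ) : ℝ) ≤
        (a (⌈t - (a 0).2⌉₊ + 1)).2 := by exact_mod_cast h1
      have h3 := Nat.le_ceil (t - (a 0).2)
      push_cast at h2
      linarith
    classical
    refine Set.mem_iUnion.2 ⟨Nat.find hex, ?_, Nat.find_spec hex⟩
    by_cases h0 : Nat.find hex = 0
    · exact Or.inl h0
    · right
      have hm := Nat.find_min hex (m := Nat.find hex - 1) (by omega)
      rw [Nat.sub_add_cancel (Nat.one_le_iff_ne_zero.2 h0)] at hm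
      exact (not_le.1 hm).le
  · intro k
    by_cases hk : k = 0
    · have : f k = Set.Iic ((a (k + 1)).2 : ℝ) := by
        ext t
        simp [f, hk]
      rw [this]
      exact isClosed_Iic
    · have : f k = Set.Icc ((a k).2 : ℝ) ((a (k + 1)).2 : ℝ) := by
        ext t
        simp [f, hk]
      rw [this]
      exact isClosed_Icc
  · intro k
    have hc : Continuous fun t : ℝ => ((a k).1 : ℝ) +
        (t - (a k).2) / ((a (k + 1)).2 - (a k).2) * ((a (k + 1)).1 - (a k).1) := by fun_prop
    exact hc.continuousOn.congr fun t ht => polyline_eq ha ht.1 ht.2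

theorem continuous_graphPath (c : ℤ × ℤ → ℝ) (p : ℝ) (u : ℤ × ℤ) :
    Continuous (graphPath c p u) :=
  continuous_polyline (strictMono_orbit c p u)

theorem continuous_tanh : Continuous Real.tanh := by
  have : Real.tanh = fun x => Real.sinh x / Real.cosh x := by
    ext x
    exact Real.tanh_eq_sinh_div_cosh x
  rw [this]
  exact Real.continuous_sinh.div Real.continuous_cosh fun x => (Real.cosh_pos x).ne'

theorem tendsto_tanh_atTop : Tendsto Real.tanh atTop (𝓝 1) := by
  have h : Real.tanh = fun x => (1 - Real.exp (-(2 * x))) / (1 + Real.exp (-(2 * x))) := by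
    ext x
    have h1 : Real.exp (-x) = Real.exp x * Real.exp (-(2 * x)) := by
      rw [← Real.exp_add]
      congr 1
      ring
    have h2 := (Real.exp_pos x).ne'
    have h3 : 1 + Real.exp (-(2 * x)) ≠ 0 := by positivity
    rw [Real.tanh_eq, h1]
    field_simp
  have he : Tendsto (fun x : ℝ => Real.exp (-(2 * x))) atTop (𝓝 0) :=
    Real.tendsto_exp_atBot.comp
      (tendsto_neg_atTop_atBot.comp (tendsto_id.const_mul_atTop two_pos))
  rw [h]
  have h1 : Tendsto (fun x : ℝ => 1 - Real.exp (-(2 * x))) atTop (𝓝 (1 - 0)) := he.const_sub 1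
  have h2 : Tendsto (fun x : ℝ => 1 + Real.exp (-(2 * x))) atTop (𝓝 (1 + 0)) := he.const_add 1
  have h3 := h1.div h2 (by norm_num)
  have h4 : ((1 : ℝ) - 0) / (1 + 0) = 1 := by norm_num
  rw [h4] at h3
  exact h3

theorem tendsto_tanh_atBot : Tendsto Real.tanh atBot (𝓝 (-1)) := by
  have := (tendsto_tanh_atTop.comp tendsto_neg_atBot_atTop).neg
  refine this.congr fun x => ?_
  simp

theorem tanhE_coe (x : ℝ) : tanhE x = Real.tanh x := by simp [tanhE]

theorem weight_coe (x : ℝ) : weight x = 1 / (1 + |x|) := by simp [weight]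

theorem abs_tanhE_le (x : EReal) : |tanhE x| ≤ 1 := by
  unfold tanhE
  split_ifs
  · simp
  · simp
  · exact (Real.abs_tanh_lt_one _).le

/-- A map on `[-∞,∞]` which is continuous on `ℝ` and has the right limits at `±∞` is continuous. -/
theorem continuous_ereal {g : EReal → ℝ} (h : Continuous fun x : ℝ => g x)
    (ht : Tendsto (fun x : ℝ => g x) atTop (𝓝 (g ⊤)))
    (hb : Tendsto (fun x : ℝ => g x) atBot (𝓝 (g ⊥))) : Continuous g := by
  refine continuous_iff_continuousAt.2 fun x => ?_
  induction x with
  | bot =>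
    rw [continuousAt_iff_punctured_nhds, EReal.nhdsWithin_bot, tendsto_map'_iff]
    exact hb
  | top =>
    rw [continuousAt_iff_punctured_nhds, EReal.nhdsWithin_top, tendsto_map'_iff]
    exact ht
  | coe x =>
    rw [ContinuousAt, EReal.nhds_coe, tendsto_map'_iff]
    exact h.tendsto x

theorem continuous_tanhE : Continuous tanhE := by
  refine continuous_ereal ?_ ?_ ?_
  · simpa only [tanhE_coe] using continuous_tanh
  · simpa [tanhE_coe, tanhE] using tendsto_tanh_atTop
  · simpa [tanhE_coe, tanhE] using tendsto_tanh_atBot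

open Classical in
/-- The values of a real function as a map to `[-∞,∞] ∪ {∗}`, with value `∗` at `±∞`. -/
def withStar (f : ℝ → ℝ) (t : EReal) : Option EReal :=
  if t = ⊤ ∨ t = ⊥ then none else some ((f t.toReal : ℝ) : EReal)

theorem continuous_compactify_withStar {f : ℝ → ℝ} (hf : Continuous f) :
    Continuous fun t => compactify (withStar f t) t := by
  refine Continuous.prodMk ?_ continuous_tanhE
  have hval : ∀ x : ℝ, tanhStar (withStar f x) * weight x = Real.tanh (f x) * (1 / (1 + |x|)) := by
    intro x
    rw [weight_coe]
    simp [withStar, tanhStar, tanhE_coe]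
  have hlim : ∀ l : Filter ℝ, Tendsto (fun x : ℝ => |x|) l atTop →
      Tendsto (fun x : ℝ => tanhStar (withStar f x) * weight x) l (𝓝 0) := by
    intro l hl
    simp only [hval]
    have h0 : Tendsto (fun x : ℝ => 1 / (1 + |x|)) l (𝓝 0) := by
      simp only [one_div]
      exact tendsto_inv_atTop_zero.comp (tendsto_atTop_add_const_left l 1 hl)
    refine squeeze_zero_norm (fun x => ?_) h0
    rw [Real.norm_eq_abs, abs_mul, abs_of_nonneg (by positivity : (0 : ℝ) ≤ 1 / (1 + |x|))]
    exact mul_le_of_le_one_left (by positivity) (Real.abs_tanh_lt_one _).le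
  refine continuous_ereal ?_ ?_ ?_
  · simp only [hval]
    have hne : ∀ x : ℝ, 1 + |x| ≠ 0 := fun x => by positivity
    exact (continuous_tanh.comp hf).mul
      (continuous_const.div (continuous_const.add continuous_abs) hne)
  · simpa [weight] using hlim _ tendsto_abs_atTop_atTop
  · simpa [weight] using hlim _ tendsto_abs_atBot_atTop

theorem continuous_scaled (c : ℤ × ℤ → ℝ) (p : ℝ) (u : ℤ × ℤ) (r s : ℝ) :
    Continuous fun t : ℝ => graphPath c p u (r * t) / s := by
  have h := continuous_graphPath c p u
  have h2 : Continuous fun t : ℝ => r * t := continuous_const_mul r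
  exact (h.comp h2).div_const s

/-- The element of `Π` given by the restriction to `[s,∞)` of a continuous function. -/
def WebPath.ofReal (s : ℝ) (f : ℝ → ℝ) (hf : Continuous f) : WebPath where
  start := s
  toFun := withStar f
  eq_star_iff t _ := by
    unfold withStar
    split_ifs with h <;> simp [h]
  continuousOn := (continuous_compactify_withStar hf).continuousOn

/-- The scaled path `π_u^{(n)}(σ,γ) : [u(2)/(n²γ),∞) → ℝ`, `t ↦ π_u(n²γt)/(nσ)`. -/
def scaledPath (c : ℤ × ℤ → ℝ) (p σ γ : ℝ) (n : ℕ) (u : ℤ × ℤ) : WebPath :=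
  WebPath.ofReal ((u.2 : ℝ) / ((n : ℝ) ^ 2 * γ))
    (fun t => graphPath c p u ((n : ℝ) ^ 2 * γ * t) / ((n : ℝ) * σ))
    (continuous_scaled c p u _ _)

/-- The collection `𝒳_n(σ,γ)` of the scaled paths from all open vertices. -/
def scaledPaths (c : ℤ × ℤ → ℝ) (p σ γ : ℝ) (n : ℕ) : Set WebPath :=
  scaledPath c p σ γ n '' openVertices c p

end

end Drainage

/-!
The joint exploration of two paths is awkward because an exploration step of one path may enter the
cone already explored by the other. The proof explores the configuration height by height instead.
At height `h` the state of a path is its last vertex at height at most `h` together with the age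
`k` of this vertex, and all that is known about the levels above the vertex is that its cone is
closed up to height `h`. The next level is fresh, so the move of the path in it is symmetric about
the last vertex (`setIntegral_displacement_eq_zero`): the abscissa of the last vertex is a
martingale, and so is the gap `D` between two paths, whatever their mutual dependence. Two paths
never cross (`Before.advance`), hence `D ≥ 0`, with `D = 0` exactly after coalescence.

The estimate `P(D_m > 0) ≤ C D_0 / √m` (`chain_ne_le`) follows from means at deterministic heights,
without stopping times. As long as the paths are distinct, the expected modulus of a step of `D` is
bounded below (`displacement_sub_lower`). Therefore the mean of the concave potential
`K² - ((K - D)⁺)²` decreases by at least a constant times `P(0 < D_j < K)` at height `j`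
(`integral_potential_gap_succ`); it is at most `2 K D_0` initially and stays nonnegative. As
`P(D_j ≥ K) ≤ D_0 / K` by Markov's inequality and `P(D_j > 0)` is nonincreasing in `j`, one gets
`m P(D_m > 0) ≤ C K D_0 + m D_0 / K`, and `K = √m` is the right choice. No upper bound on the
moments of a step is needed, since the potential is constant above `K`.

Equality of the states at height `h` means that the orbits share a vertex, which the joint
exploration then visits at a regeneration step; each regeneration raises the height by at least one,
so that both the number of regenerations and the height at coalescence are at most `h`
(`Generic.coal_le`). This gives the two tail bounds.

For (B₁), consider the unscaled paths through an interval at a real height `s`. Two open vertices of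
height `⌊s⌋` on either side of the interval lie outside the closed cones of these paths, so that the
paths are sandwiched between those of the two vertices (`Generic.graphPath_eq_of_sandwich`). With
windows of length of order `nε` such open vertices exist with high probability; they are found by
starting two chains one level below in states with large ages, and the probability that these have
not coalesced by the time in question is of order `ε`. The closure causes no difficulty, because the
starting times of the paths are discrete for fixed `n` (`exists_approx`).
-/

namespace Drainage


/-! ### Paths followed level by level -/

/-- The open sites of the window `[a - m, a + m]` of a level `ξ` at which `ξ` is minimal. -/
noncomputable def minimizers (p : ℝ) (ξ : ℤ → ℝ) (a : ℤ) (m : ℕ) : Finset ℤ :=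
  open Classical in (Finset.Icc (a - m) (a + m)).filter fun z =>
    ξ z < p ∧ ∀ z' ∈ Finset.Icc (a - m) (a + m), ξ z ≤ ξ z'

/-- The state of a path at a height `h` is the pair `(a, k)` for which `(a, h - k)` is its last
vertex at height at most `h`. `advance p ξ` is the transition from the height `h` to `h + 1`, where
`ξ` is the level `h + 1` of the configuration. Ties are broken to the left. -/
noncomputable def advance (p : ℝ) (ξ : ℤ → ℝ) (s : ℤ × ℕ) : ℤ × ℕ :=
  if h : (minimizers p ξ s.1 (s.2 + 1)).Nonempty then
    ((minimizers p ξ s.1 (s.2 + 1)).min' h, 0) else (s.1, s.2 + 1)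

/-- The row of a configuration at height `y`. -/
def level (c : ℤ × ℤ → ℝ) (y : ℤ) : ℤ → ℝ := fun z => c (z, y)

/-- The state at height `y + m` of the path with state `s` at height `y`. -/
noncomputable def chain (c : ℤ × ℤ → ℝ) (p : ℝ) (y : ℤ) (s : ℤ × ℕ) : ℕ → ℤ × ℕ
  | 0 => s
  | m + 1 => advance p (level c (y + m + 1)) (chain c p y s m)

theorem mem_minimizers {p : ℝ} {ξ : ℤ → ℝ} {a z : ℤ} {m : ℕ} :
    z ∈ minimizers p ξ a m ↔ (a - m ≤ z ∧ z ≤ a + m) ∧ ξ z < p ∧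
      ∀ z', a - m ≤ z' → z' ≤ a + m → ξ z ≤ ξ z' := by
  simp [minimizers, and_imp]

theorem minimizers_nonempty {p : ℝ} {ξ : ℤ → ℝ} {a z : ℤ} {m : ℕ} (h1 : a - m ≤ z)
    (h2 : z ≤ a + m) (hz : ξ z < p) : (minimizers p ξ a m).Nonempty := by
  obtain ⟨w, hw, hmin⟩ := Finset.exists_min_image (Finset.Icc (a - m) (a + m)) ξ
    ⟨z, Finset.mem_Icc.2 ⟨h1, h2⟩⟩
  refine ⟨w, mem_minimizers.2 ⟨Finset.mem_Icc.1 hw, ?_, fun z' h h' =>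
    hmin z' (Finset.mem_Icc.2 ⟨h, h'⟩)⟩⟩
  exact (hmin z (Finset.mem_Icc.2 ⟨h1, h2⟩)).trans_lt hz

theorem advance_cases (p : ℝ) (ξ : ℤ → ℝ) (a : ℤ) (k : ℕ) :
    (∃ z, advance p ξ (a, k) = (z, 0) ∧ a - (k + 1) ≤ z ∧ z ≤ a + (k + 1) ∧ ξ z < p ∧
      ∀ z', a - (k + 1) ≤ z' → z' ≤ a + (k + 1) → ξ z ≤ ξ z') ∨
    (advance p ξ (a, k) = (a, k + 1) ∧ ∀ z, a - (k + 1) ≤ z → z ≤ a + (k + 1) → p ≤ ξ z) := by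
  by_cases h : (minimizers p ξ a (k + 1)).Nonempty
  · left
    have hm := mem_minimizers.1 (Finset.min'_mem _ h)
    push_cast at hm
    exact ⟨_, by simp only [advance, h, dif_pos], hm.1.1, hm.1.2, hm.2⟩
  · right
    refine ⟨by simp only [advance, h, dif_neg, not_false_eq_true], fun z h1 h2 => ?_⟩
    by_contra hz
    exact h (minimizers_nonempty (z := z) (by push_cast; exact h1) (by push_cast; exact h2)
      (not_le.1 hz))

theorem advance_eq {p : ℝ} {ξ : ℤ → ℝ} (hξ : Function.Injective ξ) {a z : ℤ} {k : ℕ}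
    (h1 : a - (k + 1) ≤ z) (h2 : z ≤ a + (k + 1)) (hz : ξ z < p)
    (hmin : ∀ z', a - (k + 1) ≤ z' → z' ≤ a + (k + 1) → ξ z ≤ ξ z') :
    advance p ξ (a, k) = (z, 0) := by
  rcases advance_cases p ξ a k with ⟨w, hw, hw1, hw2, -, hw3⟩ | ⟨-, h⟩
  · rw [hw, hξ (le_antisymm (hw3 z h1 h2) (hmin w hw1 hw2))]
  · exact absurd hz (not_lt.2 (h z h1 h2))

theorem chain_add (c : ℤ × ℤ → ℝ) (p : ℝ) (y : ℤ) (s : ℤ × ℕ) (m n : ℕ) :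
    chain c p y s (m + n) = chain c p (y + m) (chain c p y s m) n := by
  induction n with
  | zero => rfl
  | succ n ih =>
    rw [← add_assoc, chain, chain, ih]
    congr 2
    push_cast
    ring

theorem age_chain_le (c : ℤ × ℤ → ℝ) (p : ℝ) (y : ℤ) (s : ℤ × ℕ) (m : ℕ) :
    (chain c p y s m).2 ≤ s.2 + m := by
  induction m with
  | zero => simp [chain]
  | succ m ih =>
    rw [chain]
    rcases advance_cases p (level c (y + m + 1)) (chain c p y s m).1 (chain c p y s m).2 with
      ⟨z, hz, -⟩ | ⟨hz, -⟩
    · rw [hz]; simp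
    · rw [hz]; simp only; omega

/-! ### Paths do not cross -/

/-- The left-to-right order of states: either the states are equal (the paths have coalesced) or the
later of the two last vertices lies outside the closed cone above the earlier one, with the last
vertex of `s` on the left of that of `s'`. -/
def Before (s s' : ℤ × ℕ) : Prop := s = s' ∨ s.1 + 1 + |(s.2 : ℤ) - s'.2| ≤ s'.1

theorem Before.le {s s' : ℤ × ℕ} (h : Before s s') : s.1 ≤ s'.1 := by
  rcases h with rfl | h
  · exact le_rfl
  · have := abs_nonneg ((s.2 : ℤ) - s'.2)
    omega

theorem Before.eq_of_fst {s s' : ℤ × ℕ} (h : Before s s') (h' : s'.1 ≤ s.1) : s = s' := by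
  rcases h with rfl | h
  · rfl
  · have := abs_nonneg ((s.2 : ℤ) - s'.2)
    omega

theorem Before.antisymm {s s' : ℤ × ℕ} (h : Before s s') (h' : Before s' s) : s = s' :=
  h.eq_of_fst h'.le

/-- Order preservation: the windows of two ordered states are ordered at both ends, so that two
choices in the wrong order would both lie in both windows and hence coincide. -/
theorem Before.advance {p : ℝ} {ξ : ℤ → ℝ} (hξ : Function.Injective ξ) {s s' : ℤ × ℕ}
    (h : Before s s') : Before (advance p ξ s) (advance p ξ s') := by
  rcases h with rfl | h
  · exact Or.inl rfl
  obtain ⟨a, k⟩ := s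
  obtain ⟨b, l⟩ := s'
  simp only at h
  have h1 := le_abs_self ((k : ℤ) - l)
  have h2 := neg_le_abs ((k : ℤ) - l)
  rcases advance_cases p ξ a k with ⟨z, hz, hz1, hz2, hzp, hzm⟩ | ⟨hz, hzm⟩ <;>
  rcases advance_cases p ξ b l with ⟨w, hw, hw1, hw2, hwp, hwm⟩ | ⟨hw, hwm⟩ <;>
  rw [hz, hw]
  · rcases lt_trichotomy z w with hlt | rfl | hlt
    · right
      simp only [Nat.cast_zero, sub_zero, abs_zero]
      omega
    · exact Or.inl rfl
    · have := hξ (le_antisymm (hzm w (by omega) (by omega)) (hwm z (by omega) (by omega)))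
      omega
  · right
    have : ¬ (b - (l + 1) ≤ z) := fun h3 => absurd hzp (not_lt.2 (hwm z h3 (by omega)))
    simp only [Nat.cast_zero, zero_sub, abs_neg, Nat.abs_cast]
    push_cast
    omega
  · right
    have : ¬ (w ≤ a + (k + 1)) := fun h3 => absurd hwp (not_lt.2 (hzm w (by omega) h3))
    simp only [Nat.cast_zero, sub_zero, Nat.abs_cast]
    push_cast
    omega
  · right
    simp only
    push_cast
    rw [add_sub_add_right_eq_sub]
    exact h

/-- The configurations without ties in a level and with open vertices above every vertex. They
have full probability. -/
structure Generic (p : ℝ) (c : ℤ × ℤ → ℝ) : Prop where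
  injective : ∀ y, Function.Injective (level c y)
  exists_open : ∀ u : ℤ × ℤ, ∃ k : ℕ, 1 ≤ k ∧ c (u.1, u.2 + k) < p

theorem Before.chain {p : ℝ} {c : ℤ × ℤ → ℝ} (hc : Generic p c) {s s' : ℤ × ℕ} (h : Before s s')
    (y : ℤ) (m : ℕ) : Before (chain c p y s m) (chain c p y s' m) := by
  induction m with
  | zero => exact h
  | succ m ih => exact ih.advance (hc.injective _)

/-! ### Successors and orbits -/

theorem mem_cone {u w : ℤ × ℤ} {h : ℕ} :
    w ∈ cone u h ↔ u.2 < w.2 ∧ w.2 ≤ u.2 + h ∧ |w.1 - u.1| ≤ w.2 - u.2 := by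
  simp only [cone, coneLevel, Set.mem_iUnion, Set.mem_Icc, Set.mem_ofPred_eq, exists_prop]
  constructor
  · rintro ⟨k, ⟨h1, h2⟩, -, h3, h4⟩
    refine ⟨by omega, by omega, ?_⟩
    rw [h3]
    simpa using h4
  · rintro ⟨h1, h2, h3⟩
    refine ⟨(w.2 - u.2).toNat, ⟨by omega, by omega⟩, by omega, by omega, ?_⟩
    rw [Int.toNat_of_nonneg (by omega)]
    exact h3

theorem IsSuccessor.unique {p : ℝ} {c : ℤ × ℤ → ℝ} (hc : Generic p c) {u w w' : ℤ × ℤ}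
    (h : IsSuccessor c p u w) (h' : IsSuccessor c p u w') : w = w' := by
  obtain ⟨ho, l, hl, hcl, hmin⟩ := h
  obtain ⟨ho', l', hl', hcl', hmin'⟩ := h'
  have key : ∀ {n n' : ℕ} {x x' : ℤ × ℤ}, x ∈ openVertices c p → x ∈ cone u (n + 1) →
      cone u n' ∩ openVertices c p = ∅ → n' ≤ n := by
    intro n n' x x' hx hx1 hx2
    by_contra hlt
    have : x ∈ cone u n' ∩ openVertices c p := by
      refine ⟨?_, hx⟩
      rw [mem_cone] at hx1 ⊢
      refine ⟨hx1.1, by push_cast at hx1; omega, hx1.2.2⟩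
    rw [hx2] at this
    exact this
  have e : l = l' := le_antisymm (key (x' := w) ho' hl' hcl) (key (x' := w) ho hl hcl')
  subst e
  have key2 : ∀ {x : ℤ × ℤ}, x ∈ openVertices c p → x ∈ cone u (l + 1) →
      x ∈ coneLevel u (l + 1) ∧ x.2 = u.2 + l + 1 := by
    intro x hx hx1
    have hn : x ∉ cone u l := fun h3 => by
      have : x ∈ cone u l ∩ openVertices c p := ⟨h3, hx⟩
      rw [hcl] at this
      exact this
    rw [mem_cone] at hx1 hn
    have : x.2 = u.2 + l + 1 := by
      by_contra hne
      exact hn ⟨hx1.1, by push_cast at hx1; omega, hx1.2.2⟩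
    refine ⟨⟨by omega, by push_cast; omega, ?_⟩, this⟩
    push_cast
    have h3 := hx1.2.2
    rw [this] at h3
    omega
  have h1 := key2 ho hl
  have h2 := key2 ho' hl'
  have hle : c w = c w' := le_antisymm (hmin w' ⟨h2.1, ho'⟩) (hmin' w ⟨h1.1, ho⟩)
  have e2 : w.2 = w'.2 := h1.2.trans h2.2.symm
  refine Prod.ext (hc.injective w.2 ?_) e2
  change c (w.1, w.2) = c (w'.1, w.2)
  rw [Prod.mk.eta, hle, e2]

theorem Generic.isSuccessor_nextVertex {p : ℝ} {c : ℤ × ℤ → ℝ} (hc : Generic p c) (u : ℤ × ℤ) :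
    IsSuccessor c p u (nextVertex c p u) := by
  have hex : ∃ w, IsSuccessor c p u w := by
    classical
    have h0 : ∃ l : ℕ, ∃ z : ℤ, u.1 - (l + 1 : ℕ) ≤ z ∧ z ≤ u.1 + (l + 1 : ℕ) ∧
        c (z, u.2 + (l + 1 : ℕ)) < p := by
      obtain ⟨k, hk, hk'⟩ := hc.exists_open u
      obtain ⟨l, rfl⟩ : ∃ l, k = l + 1 := ⟨k - 1, by omega⟩
      exact ⟨l, u.1, by omega, by omega, hk'⟩
    obtain ⟨z, hz1, hz2, hz⟩ := Nat.find_spec h0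
    have hmin : ∀ m < Nat.find h0, _ := fun m hm => Nat.find_min h0 hm
    set l := Nat.find h0
    obtain ⟨w, hw⟩ := minimizers_nonempty (ξ := level c (u.2 + (l + 1 : ℕ))) hz1 hz2 hz
    obtain ⟨⟨hw1, hw2⟩, hw3, hw4⟩ := mem_minimizers.1 hw
    refine ⟨(w, u.2 + (l + 1 : ℕ)), hw3, l, mem_cone.2 ⟨?_, ?_, ?_⟩, ?_, ?_⟩
    · simp only; omega
    · simp only; omega
    · simp only [add_sub_cancel_left, abs_le]
      constructor <;> omega
    · refine Set.eq_empty_of_forall_notMem ?_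
      rintro ⟨x, t⟩ ⟨hx, hxo⟩
      rw [mem_cone] at hx
      obtain ⟨h1, h2, h3⟩ := hx
      simp only [abs_le] at h1 h2 h3
      refine hmin (t - u.2 - 1).toNat (by omega) ⟨x, by omega, by omega, ?_⟩
      have : u.2 + (((t - u.2 - 1).toNat + 1 : ℕ) : ℤ) = t := by omega
      rw [this]
      exact hxo
    · rintro ⟨x, t⟩ ⟨⟨-, h1, h2⟩, -⟩
      simp only [abs_le] at h1 h2
      subst h1
      exact hw4 x (by omega) (by omega)
  simpa only [nextVertex, dif_pos hex] using hex.choose_spec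

theorem orbit_succ (c : ℤ × ℤ → ℝ) (p : ℝ) (u : ℤ × ℤ) (k : ℕ) :
    orbit c p u (k + 1) = nextVertex c p (orbit c p u k) :=
  Function.iterate_succ_apply' _ _ _

theorem orbit_add (c : ℤ × ℤ → ℝ) (p : ℝ) (u : ℤ × ℤ) (j k : ℕ) :
    orbit c p u (j + k) = orbit c p (orbit c p u j) k := by
  rw [orbit, orbit, orbit, add_comm, Function.iterate_add_apply]

/-- If the cone above `u` is closed up to the height `h`, the successor lies above it. -/
theorem Generic.lt_nextVertex {p : ℝ} {c : ℤ × ℤ → ℝ} (hc : Generic p c) {u : ℤ × ℤ} {h : ℕ}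
    (hu : cone u h ∩ openVertices c p = ∅) : u.2 + h < (nextVertex c p u).2 := by
  obtain ⟨ho, l, hl, -⟩ := hc.isSuccessor_nextVertex u
  by_contra hle
  have : nextVertex c p u ∈ cone u h ∩ openVertices c p := by
    rw [mem_cone] at hl
    exact ⟨mem_cone.2 ⟨hl.1, not_lt.1 hle, hl.2.2⟩, ho⟩
  rw [hu] at this
  exact this

theorem Generic.abs_nextVertex_sub_le {p : ℝ} {c : ℤ × ℤ → ℝ} (hc : Generic p c) (u : ℤ × ℤ) :
    |(nextVertex c p u).1 - u.1| ≤ (nextVertex c p u).2 - u.2 := by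
  obtain ⟨-, l, hl, -⟩ := hc.isSuccessor_nextVertex u
  exact (mem_cone.1 hl).2.2

/-- The states of the chain started from a vertex `u` are read off the orbit of `u`. -/
theorem Generic.chain_spec {p : ℝ} {c : ℤ × ℤ → ℝ} (hc : Generic p c) (u : ℤ × ℤ) (m : ℕ) :
    ∃ j, orbit c p u j = ((chain c p u.2 (u.1, 0) m).1, u.2 + m - (chain c p u.2 (u.1, 0) m).2) ∧
      cone (orbit c p u j) (chain c p u.2 (u.1, 0) m).2 ∩ openVertices c p = ∅ := by
  induction m with
  | zero =>
    refine ⟨0, by simp [orbit, chain], ?_⟩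
    refine Set.eq_empty_of_forall_notMem ?_
    rintro x ⟨hx, -⟩
    rw [mem_cone] at hx
    simp only [chain] at hx
    omega
  | succ m ih =>
    obtain ⟨j, hj, hcl⟩ := ih
    rw [chain]
    set s := chain c p u.2 (u.1, 0) m
    obtain ⟨a, k⟩ := s
    simp only at hj hcl
    rcases advance_cases p (level c (u.2 + m + 1)) a k with
      ⟨z, hz, hz1, hz2, hzp, hzm⟩ | ⟨hz, hzm⟩ <;> rw [hz]
    · have hs : IsSuccessor c p (orbit c p u j) (z, u.2 + m + 1) := by
        refine ⟨hzp, k, mem_cone.2 ?_, hcl, ?_⟩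
        · rw [hj]
          simp only [abs_le]
          push_cast
          refine ⟨?_, ?_, ?_, ?_⟩ <;> omega
        · rintro ⟨x, t⟩ ⟨⟨-, h1, h2⟩, -⟩
          rw [hj] at h1 h2
          simp only [abs_le] at h1 h2
          have : t = u.2 + m + 1 := by push_cast at h1; omega
          subst this
          exact hzm x (by push_cast at h2; omega) (by push_cast at h2; omega)
      have e : orbit c p u (j + 1) = (z, u.2 + m + 1) := by
        rw [orbit_succ]
        exact (hc.isSuccessor_nextVertex _).unique hc hs
      refine ⟨j + 1, ?_, ?_⟩
      · rw [e]
        push_cast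
        simp [add_assoc]
      · refine Set.eq_empty_of_forall_notMem ?_
        rintro x ⟨hx, -⟩
        rw [mem_cone] at hx
        simp only at hx
        omega
    · refine ⟨j, ?_, ?_⟩
      · rw [hj]
        refine Prod.ext rfl ?_
        push_cast
        ring
      · refine Set.eq_empty_of_forall_notMem ?_
        rintro ⟨x, t⟩ ⟨hx, hxo⟩
        rw [mem_cone] at hx
        rw [hj] at hx
        simp only [abs_le] at hx
        push_cast at hx
        by_cases ht : t = u.2 + m + 1
        · subst ht
          exact absurd hxo (not_lt.2 (hzm x (by omega) (by omega)))
        · have : (x, t) ∈ cone (orbit c p u j) k ∩ openVertices c p := by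
            refine ⟨mem_cone.2 ?_, hxo⟩
            rw [hj]
            simp only [abs_le]
            refine ⟨?_, ?_, ?_, ?_⟩ <;> omega
          rw [hcl] at this
          exact this


/-! ### The joint exploration reaches every common vertex -/

theorem pairPos_succ (c : ℤ × ℤ → ℝ) (p : ℝ) (u v : ℤ × ℤ) (n : ℕ) :
    pairPos c p u v (n + 1) =
      pairPos c p (pairStep c p (u, v)).1 (pairStep c p (u, v)).2 n := by
  simp only [pairPos, Function.iterate_succ_apply, Prod.mk.eta]

theorem pairPos_succ' (c : ℤ × ℤ → ℝ) (p : ℝ) (u v : ℤ × ℤ) (n : ℕ) :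
    pairPos c p u v (n + 1) = pairStep c p (pairPos c p u v n) := by
  simp only [pairPos, Function.iterate_succ_apply']

theorem orbit_height_le (c : ℤ × ℤ → ℝ) (p : ℝ) (u : ℤ × ℤ) (j : ℕ) :
    u.2 ≤ (orbit c p u j).2 :=
  (strictMono_orbit c p u).monotone (Nat.zero_le j)

theorem orbit_succ' (c : ℤ × ℤ → ℝ) (p : ℝ) (u : ℤ × ℤ) (k : ℕ) :
    orbit c p u (k + 1) = orbit c p (nextVertex c p u) k :=
  Function.iterate_succ_apply _ _ _

/-- The joint exploration does not skip a common vertex of the two orbits. -/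
theorem exists_pairPos_eq (c : ℤ × ℤ → ℝ) (p : ℝ) (N : ℕ) : ∀ (u v : ℤ × ℤ) (i j : ℕ),
    i + j ≤ N → orbit c p u i = orbit c p v j →
      ∃ n, pairPos c p u v n = (orbit c p u i, orbit c p v j) ∧ (1 ≤ i → 1 ≤ n) := by
  induction N with
  | zero =>
    intro u v i j hij _
    obtain ⟨rfl, rfl⟩ : i = 0 ∧ j = 0 := by omega
    exact ⟨0, rfl, by omega⟩
  | succ N ih =>
    intro u v i j hij h
    have hi := orbit_height_le c p u i
    have hj := orbit_height_le c p v j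
    have hi1 : 1 ≤ i → u.2 < (orbit c p u i).2 := fun h1 => strictMono_orbit c p u h1
    have hj1 : 1 ≤ j → v.2 < (orbit c p v j).2 := fun h1 => strictMono_orbit c p v h1
    have hi0 : i = 0 → (orbit c p u i).2 = u.2 := by rintro rfl; rfl
    have hj0 : j = 0 → (orbit c p v j).2 = v.2 := by rintro rfl; rfl
    rw [h] at hi hi1 hi0
    have huse : ∀ u' v' i' j', pairStep c p (u, v) = (u', v') → i' + j' ≤ N →
        orbit c p u' i' = orbit c p u i → orbit c p v' j' = orbit c p v j →
        ∃ n, pairPos c p u v n = (orbit c p u i, orbit c p v j) ∧ (1 ≤ i → 1 ≤ n) := by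
      intro u' v' i' j' hs hN h1 h2
      obtain ⟨n, hn, -⟩ := ih u' v' i' j' hN (by rw [h1, h2, h])
      exact ⟨n + 1, by rw [pairPos_succ, hs, hn, h1, h2], fun _ => by omega⟩
    rcases lt_trichotomy u.2 v.2 with hlt | heq | hlt
    · obtain ⟨i', rfl⟩ : ∃ i', i = i' + 1 := ⟨i - 1, by omega⟩
      refine huse (nextVertex c p u) v i' j ?_ (by omega) (orbit_succ' c p u i').symm rfl
      simp [pairStep, min_eq_left hlt.le, hlt.ne']
    · by_cases h0 : i = 0
      · have : j = 0 := by omega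
        subst h0 this
        exact ⟨0, rfl, by omega⟩
      · obtain ⟨i', rfl⟩ : ∃ i', i = i' + 1 := ⟨i - 1, by omega⟩
        obtain ⟨j', rfl⟩ : ∃ j', j = j' + 1 := ⟨j - 1, by omega⟩
        refine huse (nextVertex c p u) (nextVertex c p v) i' j' ?_ (by omega)
          (orbit_succ' c p u i').symm (orbit_succ' c p v j').symm
        simp [pairStep, heq]
    · obtain ⟨j', rfl⟩ : ∃ j', j = j' + 1 := ⟨j - 1, by omega⟩
      refine huse u (nextVertex c p v) i j' ?_ (by omega) rfl (orbit_succ' c p v j').symm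
      simp [pairStep, min_eq_right hlt.le, hlt.ne']

theorem height_le_pairStep (c : ℤ × ℤ → ℝ) (p : ℝ) (a : (ℤ × ℤ) × (ℤ × ℤ)) :
    a.1.2 ≤ (pairStep c p a).1.2 := by
  simp only [pairStep]
  split_ifs
  · exact (height_lt_nextVertex c p _).le
  · exact le_rfl

theorem monotone_pairPos_height (c : ℤ × ℤ → ℝ) (p : ℝ) (u v : ℤ × ℤ) :
    Monotone fun n => (pairPos c p u v n).1.2 := by
  refine monotone_nat_of_le_succ fun n => ?_
  simp only [pairPos_succ']
  exact height_le_pairStep c p _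

theorem pairPos_height_lt {c : ℤ × ℤ → ℝ} {p : ℝ} {u v : ℤ × ℤ} {n : ℕ}
    (h : (pairPos c p u v n).1.2 = (pairPos c p u v n).2.2) :
    (pairPos c p u v n).1.2 < (pairPos c p u v (n + 1)).1.2 := by
  rw [pairPos_succ']
  simp only [pairStep, h, min_self, if_true]
  rw [← h]
  exact height_lt_nextVertex c p _

/-- Every exploration step at which the heights agree is a regeneration, and each regeneration
raises the height. -/
theorem exists_regenStep_eq (c : ℤ × ℤ → ℝ) (p : ℝ) {u v : ℤ × ℤ} (huv : u.2 = v.2) (n : ℕ) :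
    (pairPos c p u v n).1.2 = (pairPos c p u v n).2.2 →
      ∃ l : ℕ, regenStep c p u v l = n ∧ u.2 + l ≤ (pairPos c p u v n).1.2 ∧
        (1 ≤ n → 1 ≤ l) := by
  induction n using Nat.strong_induction_on with
  | _ n ih =>
    intro hn
    by_cases h0 : n = 0
    · subst h0
      exact ⟨0, rfl, by simp [pairPos], by omega⟩
    classical
    -- the last earlier step at which the heights agree
    let P : ℕ → Prop := fun m => m < n ∧ (pairPos c p u v m).1.2 = (pairPos c p u v m).2.2
    have hP0 : P 0 := ⟨by omega, huv⟩
    let m := Nat.findGreatest P n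
    have hm : P m := Nat.findGreatest_spec (Nat.zero_le n) hP0
    have hmax : ∀ k, P k → k ≤ m := fun k hk => Nat.le_findGreatest hk.1.le hk
    obtain ⟨l, hl, hl2, -⟩ := ih m hm.1 hm.2
    refine ⟨l + 1, ?_, ?_, fun _ => by omega⟩
    · rw [regenStep, hl]
      refine le_antisymm (sInf_le ⟨n, rfl, by exact_mod_cast hm.1, hn⟩) (le_sInf ?_)
      rintro _ ⟨k, rfl, hk1, hk2⟩
      have hk1 : m < k := by exact_mod_cast hk1
      by_contra hlt
      have hlt : k < n := by exact_mod_cast not_le.1 hlt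
      have := hmax k ⟨hlt, hk2⟩
      omega
    · have h1 := pairPos_height_lt hm.2
      have h2 : (pairPos c p u v (m + 1)).1.2 ≤ (pairPos c p u v n).1.2 :=
        monotone_pairPos_height c p u v hm.1
      push_cast
      omega

theorem monotone_regenStep (c : ℤ × ℤ → ℝ) (p : ℝ) (u v : ℤ × ℤ) :
    Monotone (regenStep c p u v) := by
  refine monotone_nat_of_le_succ fun l => ?_
  rw [regenStep]
  refine le_sInf ?_
  rintro _ ⟨k, rfl, hk, -⟩
  exact hk.le

/-- If the orbits of two vertices of the same height share a vertex at most `h` higher up, they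
have coalesced in at most `h` regeneration steps and at a height at most `h`. -/
theorem coal_le_of_orbit_eq {c : ℤ × ℤ → ℝ} {p : ℝ} {u v : ℤ × ℤ} (huv : u.2 = v.2) (hne : u ≠ v)
    {i j h : ℕ} (hij : orbit c p u i = orbit c p v j) (hh : (orbit c p u i).2 ≤ u.2 + h) :
    coalSteps c p u v ≤ h ∧ coalHeight c p u v ≤ ((h : ℝ) : EReal) := by
  have hi : 1 ≤ i := by
    by_contra h0
    obtain rfl : i = 0 := by omega
    have h1 : u = orbit c p v j := hij
    by_cases hj : j = 0
    · subst hj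
      exact hne h1
    · have h2 : v.2 < (orbit c p v j).2 := strictMono_orbit c p v (by omega : 0 < j)
      rw [← h1] at h2
      omega
  obtain ⟨n, hn, hn1⟩ := exists_pairPos_eq c p _ u v i j le_rfl hij
  have hn1 := hn1 hi
  have hnh : (pairPos c p u v n).1.2 = (pairPos c p u v n).2.2 := by rw [hn, hij]
  obtain ⟨l, hl, hl2, hl3⟩ := exists_regenStep_eq c p huv n hnh
  have hl3 := hl3 hn1
  have hlh : l ≤ h := by
    rw [hn] at hl2
    simp only at hl2
    omega
  have hmem : (l : ℕ∞) ∈ {n : ℕ∞ | ∃ m : ℕ, n = (m : ℕ∞) ∧ 1 ≤ m ∧ regenStep c p u v m ≠ ⊤ ∧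
      regenDiff c p u v m = 0} := by
    refine ⟨l, rfl, hl3, by rw [hl]; exact ENat.natCast_ne_top n, ?_⟩
    simp only [regenDiff, hl, ENat.toNat_natCast, hn, hij, sub_self]
  have hcl : coalSteps c p u v ≤ l := sInf_le hmem
  refine ⟨hcl.trans (by exact_mod_cast hlh), ?_⟩
  have hct : coalSteps c p u v ≠ ⊤ := (hcl.trans_lt (ENat.natCast_lt_top l)).ne
  obtain ⟨k, hk⟩ := ENat.ne_top_iff_exists.1 hct
  rw [← hk] at hcl
  have hcl : k ≤ l := by exact_mod_cast hcl
  have hkl : regenStep c p u v k ≤ n := hl ▸ monotone_regenStep c p u v hcl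
  have hkt : regenStep c p u v k ≠ ⊤ := (hkl.trans_lt (ENat.natCast_lt_top n)).ne
  obtain ⟨q, hq⟩ := ENat.ne_top_iff_exists.1 hkt
  rw [← hq] at hkl
  have hqn : q ≤ n := by exact_mod_cast hkl
  rw [coalHeight, if_neg hct, ← hk, ENat.toNat_natCast, regenHeight, if_neg hkt, ← hq,
    ENat.toNat_natCast]
  have h1 : (pairPos c p u v q).1.2 ≤ (pairPos c p u v n).1.2 :=
    monotone_pairPos_height c p u v hqn
  rw [hn] at h1
  rw [EReal.coe_le_coe_iff]
  have h2 : (pairPos c p u v q).1.2 - u.2 ≤ h := by simp only at h1; omega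
  exact_mod_cast h2

/-- Equality of the states at some height means coalescence up to that height. -/
theorem Generic.coal_le {p : ℝ} {c : ℤ × ℤ → ℝ} (hc : Generic p c) {a b y : ℤ} (hab : a ≠ b)
    {h : ℕ} (heq : chain c p y (a, 0) h = chain c p y (b, 0) h) :
    coalSteps c p (a, y) (b, y) ≤ h ∧ coalHeight c p (a, y) (b, y) ≤ ((h : ℝ) : EReal) := by
  obtain ⟨i, hi, -⟩ := hc.chain_spec (a, y) h
  obtain ⟨j, hj, -⟩ := hc.chain_spec (b, y) h
  simp only at hi hj
  rw [← heq] at hj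
  refine coal_le_of_orbit_eq (u := (a, y)) (v := (b, y)) (i := i) (j := j) rfl 
    (fun h => hab (congrArg Prod.fst h)) (hi.trans hj.symm) ?_
  rw [hi]
  simp only
  omega

/-! ### The polygonal paths -/

/-- A path coincides above each of its vertices with the path started there. -/
theorem graphPath_orbit (c : ℤ × ℤ → ℝ) (p : ℝ) (u : ℤ × ℤ) (j : ℕ) {t : ℝ}
    (ht : ((orbit c p u j).2 : ℝ) ≤ t) :
    graphPath c p u t = graphPath c p (orbit c p u j) t := by
  classical
  have hex : ∃ k : ℕ, t < (orbit c p (orbit c p u j) (k + 1)).2 := by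
    have hm := strictMono_orbit c p (orbit c p u j)
    have hgrow : ∀ k : ℕ, (orbit c p u j).2 + k ≤ (orbit c p (orbit c p u j) k).2 := by
      intro k
      induction k with
      | zero => simp [orbit]
      | succ k ih =>
        have := hm (Nat.lt_succ_self k)
        simp only [Nat.succ_eq_add_one] at this
        push_cast
        omega
    refine ⟨⌈t - (orbit c p u j).2⌉₊, ?_⟩
    have h1 := hgrow (⌈t - (orbit c p u j).2⌉₊ + 1)
    have h2 : (((orbit c p u j).2 + ((⌈t - (orbit c p u j).2⌉₊ + 1 : ℕ) : ℤ) : ℤ) : ℝ) ≤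
      (orbit c p (orbit c p u j) (⌈t - (orbit c p u j).2⌉₊ + 1)).2 := by exact_mod_cast h1
    have h3 := Nat.le_ceil (t - (orbit c p u j).2)
    push_cast at h2
    linarith
  have hk := Nat.find_spec hex
  set k := Nat.find hex
  have hk' : ((orbit c p (orbit c p u j) k).2 : ℝ) ≤ t := by
    by_cases h0 : k = 0
    · rw [h0]; exact ht
    · have hm := Nat.find_min hex (m := k - 1) (by omega)
      rw [Nat.sub_add_cancel (Nat.one_le_iff_ne_zero.2 h0)] at hm
      exact not_lt.1 hm
  rw [graphPath, graphPath, polyline_eq (strictMono_orbit c p _) (Or.inr hk') hk.le,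
    polyline_eq (strictMono_orbit c p u) (k := j + k) (Or.inr (by rw [orbit_add]; exact hk'))
      (by rw [add_assoc, orbit_add]; exact hk.le), add_assoc]
  simp only [orbit_add]

/-- Up to its first successor, a path stays in the cone above its starting point. -/
theorem Generic.abs_graphPath_sub_le {p : ℝ} {c : ℤ × ℤ → ℝ} (hc : Generic p c) (u : ℤ × ℤ) {t : ℝ}
    (h1 : (u.2 : ℝ) ≤ t) (h2 : t ≤ (nextVertex c p u).2) : |graphPath c p u t - u.1| ≤ t - u.2 := by
  have e : orbit c p u 1 = nextVertex c p u := rfl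
  have hlt : (u.2 : ℝ) < (nextVertex c p u).2 := by exact_mod_cast height_lt_nextVertex c p u
  have habs : |((nextVertex c p u).1 : ℝ) - u.1| ≤ (nextVertex c p u).2 - u.2 := by
    exact_mod_cast hc.abs_nextVertex_sub_le u
  rw [graphPath, polyline_eq (strictMono_orbit c p u) (k := 0) (Or.inl rfl)
    (by rw [zero_add, e]; exact h2), zero_add, e]
  change |((u.1 : ℤ) : ℝ) + (t - u.2) / ((nextVertex c p u).2 - u.2) *
    ((nextVertex c p u).1 - u.1) - u.1| ≤ _
  rw [add_sub_cancel_left, abs_mul, abs_div, abs_of_nonneg (sub_nonneg.2 h1),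
    abs_of_pos (sub_pos.2 hlt), div_mul_eq_mul_div, div_le_iff₀ (sub_pos.2 hlt)]
  exact mul_le_mul_of_nonneg_left habs (sub_nonneg.2 h1)

/-- Sandwich: a path from an open vertex which passes at the height `s ∈ [y, y + 1)` well between
two open vertices of height `y` stays between the paths from these. In particular it is determined
from the height at which these have coalesced on. -/
theorem Generic.graphPath_eq_of_sandwich {p : ℝ} {c : ℤ × ℤ → ℝ} (hc : Generic p c) {i j y : ℤ}
    {h : ℕ} (hi : c (i, y) < p) (hj : c (j, y) < p)
    (heq : chain c p y (i, 0) h = chain c p y (j, 0) h) {s s' : ℝ} (hs1 : (y : ℝ) ≤ s)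
    (hs2 : s < y + 1) (hs' : (y : ℝ) + h ≤ s') {u : ℤ × ℤ} (hu : (u.2 : ℝ) ≤ s)
    (hiu : (i : ℝ) + 1 < graphPath c p u s) (hju : graphPath c p u s + 1 < j) :
    graphPath c p u s' = graphPath c p (i, y) s' := by
  have huy : u.2 ≤ y := by
    have : (u.2 : ℝ) < y + 1 := hu.trans_lt hs2
    have : u.2 < y + 1 := by exact_mod_cast this
    omega
  obtain ⟨m, hm⟩ : ∃ m : ℕ, y = u.2 + m := ⟨(y - u.2).toNat, by omega⟩
  set S := chain c p u.2 (u.1, 0) m with hS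
  obtain ⟨r, hr, hcl⟩ := hc.chain_spec u m
  rw [← hS, ← hm] at hr
  rw [← hS] at hcl
  obtain ⟨a, k⟩ := S
  simp only at hr hcl
  have hnext := hc.lt_nextVertex hcl
  rw [hr] at hnext
  simp only [sub_add_cancel] at hnext
  have hrs : ((orbit c p u r).2 : ℝ) ≤ s := by
    rw [hr]
    push_cast
    have : (0 : ℝ) ≤ k := Nat.cast_nonneg k
    linarith
  have hpos := hc.abs_graphPath_sub_le (orbit c p u r) hrs (by
    rw [hr]
    have : y + 1 ≤ (nextVertex c p (a, y - k)).2 := hnext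
    have : (y : ℝ) + 1 ≤ (nextVertex c p (a, y - k)).2 := by exact_mod_cast this
    linarith)
  rw [← graphPath_orbit c p u r hrs, hr, abs_le] at hpos
  push_cast at hpos
  -- an open vertex at height `y` is outside the closed cone above the last vertex of the path
  have hout : ∀ z : ℤ, c (z, y) < p → 1 ≤ k → ¬ |z - a| ≤ k := by
    intro z hz hk hle
    have : ((z, y) : ℤ × ℤ) ∈ cone (orbit c p u r) k ∩ openVertices c p := by
      refine ⟨mem_cone.2 ?_, hz⟩
      rw [hr]
      simp only
      refine ⟨by omega, by omega, by omega⟩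
    rw [hcl] at this
    exact this
  have hia : i < a + k + 1 := by
    have : (i : ℝ) < a + k + 1 := by linarith
    exact_mod_cast this
  have hja : a - k - 1 < j := by
    have : (a : ℝ) - k - 1 < j := by linarith
    exact_mod_cast this
  have hB1 : Before (i, 0) (a, k) := by
    right
    simp only [Nat.cast_zero, zero_sub, abs_neg, Nat.abs_cast]
    rcases Nat.eq_zero_or_pos k with rfl | hk
    · have : (i : ℝ) < a := by push_cast at hpos; linarith
      have : i < a := by exact_mod_cast this
      push_cast; omega
    · have := hout i hi hk
      rw [abs_le] at this
      omega
  have hB2 : Before (a, k) (j, 0) := by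
    right
    simp only [Nat.cast_zero, sub_zero, Nat.abs_cast]
    rcases Nat.eq_zero_or_pos k with rfl | hk
    · have : (a : ℝ) < j := by push_cast at hpos; linarith
      have : a < j := by exact_mod_cast this
      push_cast; omega
    · have := hout j hj hk
      rw [abs_le] at this
      omega
  have hfin : chain c p y (a, k) h = chain c p y (i, 0) h :=
    Before.antisymm (heq ▸ hB2.chain hc y h) (hB1.chain hc y h)
  obtain ⟨q, hq, -⟩ := hc.chain_spec u (m + h)
  obtain ⟨q', hq', -⟩ := hc.chain_spec (i, y) h
  rw [chain_add, ← hS, ← hm, hfin] at hq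
  simp only at hq'
  have e : orbit c p u q = orbit c p (i, y) q' := by
    rw [hq, hq']
    push_cast
    rw [← add_assoc, ← hm]
  have hle : ((orbit c p (i, y) q').2 : ℝ) ≤ s' := by
    rw [hq']
    push_cast
    have : (0 : ℝ) ≤ (chain c p y (i, 0) h).2 := Nat.cast_nonneg _
    linarith
  rw [graphPath_orbit c p u q (by rw [e]; exact hle), graphPath_orbit c p (i, y) q' hle, e]


/-! ### The law of the field -/

/-- The uniform distribution on `(0,1)`. -/
noncomputable def uniformLaw : Measure ℝ := (volume : Measure ℝ).restrict (Set.Ioo 0 1)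

instance isProbabilityMeasure_uniformLaw : IsProbabilityMeasure uniformLaw :=
  ⟨by simp [uniformLaw]⟩

/-- The law of the i.i.d. uniform field, on the space of configurations. -/
noncomputable def fieldLaw : Measure (ℤ × ℤ → ℝ) := Measure.infinitePi fun _ => uniformLaw

instance isProbabilityMeasure_fieldLaw : IsProbabilityMeasure fieldLaw := by
  unfold fieldLaw; infer_instance

theorem IsUniformField.map_eq {Ω : Type*} [MeasurableSpace Ω] {P : Measure Ω}
    [IsProbabilityMeasure P] {U : ℤ × ℤ → Ω → ℝ} (h : IsUniformField P U) :
    P.map (fun ω w => U w ω) = fieldLaw := by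
  rw [h.indep.map_fun_eq_infinitePi_map h.measurable, fieldLaw]
  congr 1
  funext w
  exact h.law w

theorem IsUniformField.le_fieldLaw {Ω : Type*} [MeasurableSpace Ω] {P : Measure Ω}
    [IsProbabilityMeasure P] {U : ℤ × ℤ → Ω → ℝ} (h : IsUniformField P U)
    (E : Set (ℤ × ℤ → ℝ)) : P {ω | (fun w => U w ω) ∈ E} ≤ fieldLaw E := by
  rw [← h.map_eq]
  exact Measure.le_map_apply (measurable_pi_lambda _ h.measurable).aemeasurable E

theorem uniformLaw_Iio {q : ℝ} (h1 : q ≤ 1) : uniformLaw (Set.Iio q) = ENNReal.ofReal q := by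
  rw [uniformLaw, Measure.restrict_apply measurableSet_Iio]
  have : Set.Iio q ∩ Set.Ioo 0 1 = Set.Ioo 0 q := by
    ext x
    simp only [Set.mem_inter_iff, Set.mem_Iio, Set.mem_Ioo]
    constructor
    · rintro ⟨h, h', -⟩; exact ⟨h', h⟩
    · rintro ⟨h, h'⟩; exact ⟨h', h, h'.trans_le h1⟩
  rw [this, Real.volume_Ioo, sub_zero]

theorem uniformLaw_Ici {q : ℝ} (h0 : 0 < q) :
    uniformLaw (Set.Ici q) = ENNReal.ofReal (1 - q) := by
  rw [uniformLaw, Measure.restrict_apply measurableSet_Ici]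
  have : Set.Ici q ∩ Set.Ioo 0 1 = Set.Ico q 1 := by
    ext x
    simp only [Set.mem_inter_iff, Set.mem_Ici, Set.mem_Ioo, Set.mem_Ico]
    constructor
    · rintro ⟨h, -, h'⟩; exact ⟨h, h'⟩
    · rintro ⟨h, h'⟩; exact ⟨h, h0.trans_le h, h'⟩
  rw [this, Real.volume_Ico]

theorem fieldLaw_map_comp {f : ℤ × ℤ → ℤ × ℤ} (hf : Function.Injective f) :
    fieldLaw.map (fun c w => c (f w)) = fieldLaw :=
  Measure.map_infinitePi_infinitePi_of_inj (P := fun _ : ℤ × ℤ => uniformLaw) hf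

/-- The probability that finitely many sites are all closed. -/
theorem fieldLaw_forall_le (F : Finset (ℤ × ℤ)) {q : ℝ} (hq : 0 < q) :
    fieldLaw {c | ∀ w ∈ F, q ≤ c w} = ENNReal.ofReal (1 - q) ^ F.card := by
  have : {c : ℤ × ℤ → ℝ | ∀ w ∈ F, q ≤ c w} = Set.pi F fun _ => Set.Ici q := by
    ext c; simp
  rw [this, fieldLaw, Measure.infinitePi_pi _ fun _ _ => measurableSet_Ici]
  simp [uniformLaw_Ici hq]

theorem fieldLaw_lt_and_forall_le (r : ℤ × ℤ) (F : Finset (ℤ × ℤ)) (hr : r ∉ F) {q : ℝ}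
    (hq : 0 < q) (hq1 : q ≤ 1) :
    fieldLaw {c | c r < q ∧ ∀ w ∈ F, q ≤ c w} =
      ENNReal.ofReal q * ENNReal.ofReal (1 - q) ^ F.card := by
  classical
  have hne : ∀ w ∈ F, w ≠ r := fun w hw e => hr (e ▸ hw)
  have : {c : ℤ × ℤ → ℝ | c r < q ∧ ∀ w ∈ F, q ≤ c w} =
      Set.pi (insert r F : Finset (ℤ × ℤ)) fun w => if w = r then Set.Iio q else Set.Ici q := by
    ext c
    simp only [Set.mem_ofPred_eq, Finset.coe_insert, Set.mem_pi, Set.mem_insert_iff,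
      Finset.mem_coe, forall_eq_or_imp, if_true, Set.mem_Iio]
    refine and_congr_right fun _ => forall₂_congr fun w hw => ?_
    rw [if_neg (hne w hw), Set.mem_Ici]
  rw [this, fieldLaw, Measure.infinitePi_pi _ fun w _ => by
    split_ifs; exacts [measurableSet_Iio, measurableSet_Ici], Finset.prod_insert hr, if_pos rfl,
    uniformLaw_Iio hq1, Finset.prod_congr rfl fun w hw => by rw [if_neg (hne w hw)],
    Finset.prod_const, uniformLaw_Ici hq]

theorem ae_ne {w z : ℤ × ℤ} (h : w ≠ z) : ∀ᵐ c ∂fieldLaw, c w ≠ c z := by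
  have hmap := Measure.infinitePi_map_eval_prod (P := fun _ : ℤ × ℤ => uniformLaw) h
  have hd : MeasurableSet {x : ℝ × ℝ | x.1 = x.2} := measurableSet_eq_fun measurable_fst
    measurable_snd
  have h0 : (uniformLaw.prod uniformLaw) {x : ℝ × ℝ | x.1 = x.2} = 0 := by
    rw [Measure.measure_prod_null hd]
    refine Eventually.of_forall fun x => ?_
    have : (Prod.mk x ⁻¹' {x : ℝ × ℝ | x.1 = x.2}) = {x} := by
      ext y; simp [eq_comm]
    change uniformLaw (Prod.mk x ⁻¹' {x : ℝ × ℝ | x.1 = x.2}) = 0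
    rw [this, uniformLaw]
    exact le_antisymm ((Measure.restrict_apply_le _ _).trans (by simp)) zero_le
  rw [← hmap, Measure.map_apply (by fun_prop) hd] at h0
  rw [ae_iff]
  simpa [fieldLaw] using h0

/-- Almost every configuration is generic. -/
theorem ae_generic {p : ℝ} (hp0 : 0 < p) : ∀ᵐ c ∂fieldLaw, Generic p c := by
  have h1 : ∀ᵐ c ∂fieldLaw, ∀ w z : ℤ × ℤ, w ≠ z → c w ≠ c z :=
    ae_all_iff.2 fun w => ae_all_iff.2 fun z => by
      by_cases h : w = z
      · exact Eventually.of_forall fun c hne => absurd h hne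
      · exact (ae_ne h).mono fun c hc _ => hc
  have h2 : ∀ᵐ c ∂fieldLaw, ∀ u : ℤ × ℤ, ∃ k : ℕ, 1 ≤ k ∧ c (u.1, u.2 + k) < p := by
    refine ae_all_iff.2 fun u => ?_
    rw [ae_iff]
    have hinj : Function.Injective fun k : ℕ => ((u.1, u.2 + (k + 1 : ℕ)) : ℤ × ℤ) := by
      intro k l h
      simpa using congrArg Prod.snd h
    have hle : ∀ n : ℕ, fieldLaw {c | ¬ ∃ k : ℕ, 1 ≤ k ∧ c (u.1, u.2 + k) < p} ≤
        ENNReal.ofReal (1 - p) ^ n := by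
      intro n
      refine le_trans (measure_mono ?_) (fieldLaw_forall_le
        ((Finset.range n).map ⟨_, hinj⟩) hp0).le |>.trans (by simp)
      intro c hc w hw
      simp only [Finset.mem_map, Finset.mem_range, Function.Embedding.coeFn_mk] at hw
      obtain ⟨k, -, rfl⟩ := hw
      by_contra hlt
      exact hc ⟨k + 1, by omega, not_le.1 hlt⟩
    refine le_antisymm (ge_of_tendsto' (ENNReal.tendsto_pow_atTop_nhds_zero_of_lt_one ?_) hle)
      zero_le
    rw [ENNReal.ofReal_lt_one]
    linarith
  filter_upwards [h1, h2] with c hc1 hc2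
  refine ⟨fun y a b hab => ?_, hc2⟩
  by_contra hne
  exact hc1 (a, y) (b, y) (fun h => hne (congrArg Prod.fst h)) hab

/-- Functions of disjoint sets of sites are independent. -/
theorem fieldLaw_inter_of_dependsOn {B A : Set (ℤ × ℤ → ℝ)} (hB : MeasurableSet B)
    (hA : MeasurableSet A) {S T : Set (ℤ × ℤ)} (hST : Disjoint S T)
    (hBS : DependsOn (fun c => c ∈ B) S) (hAT : DependsOn (fun c => c ∈ A) T) :
    fieldLaw (B ∩ A) = fieldLaw B * fieldLaw A := by
  classical
  have key : ∀ {E : Set (ℤ × ℤ → ℝ)} {S : Set (ℤ × ℤ)}, MeasurableSet E →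
      DependsOn (fun c => c ∈ E) S →
      MeasurableSet[⨆ i ∈ S, MeasurableSpace.comap (fun c : ℤ × ℤ → ℝ => c i) inferInstance] E := by
    intro E S hE hES
    let ψ : (ℤ × ℤ → ℝ) → (ℤ × ℤ → ℝ) := fun c w => if w ∈ S then c w else 0
    have hψ : Measurable[⨆ i ∈ S, MeasurableSpace.comap (fun c : ℤ × ℤ → ℝ => c i) inferInstance]
        ψ := by
      refine @measurable_pi_lambda _ _ _ (_) _ _ fun w => ?_
      by_cases hw : w ∈ S
      · simp only [ψ, if_pos hw]
        exact Measurable.mono (comap_measurable _) (le_iSup₂_of_le w hw le_rfl) le_rfl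
      · simp only [ψ, if_neg hw]
        exact @measurable_const _ _ _ (_) _
    have : E = ψ ⁻¹' E := by
      ext c
      exact iff_of_eq (hES fun w hw => by simp [ψ, hw])
    rw [this]
    exact hψ hE
  have hind : iIndep (fun i : ℤ × ℤ => MeasurableSpace.comap (fun c : ℤ × ℤ → ℝ => c i)
      inferInstance) fieldLaw :=
    iIndepFun_infinitePi (P := fun _ : ℤ × ℤ => uniformLaw) (X := fun _ x => x)
      fun _ => measurable_id
  have := indep_iSup_of_disjoint (fun i => (measurable_pi_apply i).comap_le) hind hST
  rw [Indep_iff] at this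
  exact this B A (key hB hBS) (key hA hAT)

/-! ### Measurability of the chains -/

theorem measurableSet_mem_minimizers (p : ℝ) (a z : ℤ) (m : ℕ) :
    MeasurableSet {ξ : ℤ → ℝ | z ∈ minimizers p ξ a m} := by
  simp only [mem_minimizers]
  have h : ∀ z', MeasurableSet {ξ : ℤ → ℝ | a - m ≤ z' → z' ≤ a + m → ξ z ≤ ξ z'} := fun z' =>
    (MeasurableSet.const _).imp ((MeasurableSet.const _).imp
      (measurableSet_le (measurable_pi_apply z) (measurable_pi_apply z')))
  have h' : MeasurableSet {ξ : ℤ → ℝ | ∀ z', a - m ≤ z' → z' ≤ a + m → ξ z ≤ ξ z'} := by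
    rw [Set.ofPred_forall]
    exact MeasurableSet.iInter h
  exact (MeasurableSet.const _).inter
    ((measurableSet_lt (measurable_pi_apply z) measurable_const).inter h')

theorem measurable_advance (p : ℝ) (s : ℤ × ℕ) : Measurable fun ξ => advance p ξ s := by
  let _ : MeasurableSpace (Finset ℤ) := ⊤
  have h1 : Measurable fun ξ : ℤ → ℝ => minimizers p ξ s.1 (s.2 + 1) := by
    refine measurable_to_countable' fun F => ?_
    have : (fun ξ : ℤ → ℝ => minimizers p ξ s.1 (s.2 + 1)) ⁻¹' {F} =
        ⋂ z, {ξ | z ∈ minimizers p ξ s.1 (s.2 + 1) ↔ z ∈ F} := by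
      ext ξ
      simp [Finset.ext_iff]
    rw [this]
    exact MeasurableSet.iInter fun z =>
      (measurableSet_mem_minimizers p s.1 z (s.2 + 1)).iff (.const _)
  have h2 : Measurable fun F : Finset ℤ =>
      if h : F.Nonempty then ((F.min' h, 0) : ℤ × ℕ) else (s.1, s.2 + 1) := measurable_from_top
  exact h2.comp h1

theorem measurable_level (y : ℤ) : Measurable fun c : ℤ × ℤ → ℝ => level c y :=
  measurable_pi_lambda _ fun z => measurable_pi_apply (z, y)

theorem measurable_chain (p : ℝ) (y : ℤ) (s : ℤ × ℕ) (m : ℕ) :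
    Measurable fun c => chain c p y s m := by
  induction m with
  | zero => exact measurable_const
  | succ m ih =>
    refine measurable_to_countable' fun x => ?_
    have : (fun c => chain c p y s (m + 1)) ⁻¹' {x} =
        ⋃ s', ((fun c => chain c p y s m) ⁻¹' {s'}) ∩
          (fun c => advance p (level c (y + m + 1)) s') ⁻¹' {x} := by
      ext c
      simp [chain]
    rw [this]
    exact MeasurableSet.iUnion fun s' => (ih (measurableSet_singleton s')).inter
      (((measurable_advance p s').comp (measurable_level _)) (measurableSet_singleton x))

theorem dependsOn_chain (p : ℝ) (y : ℤ) (s : ℤ × ℕ) (m : ℕ) :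
    DependsOn (fun c => chain c p y s m) {w | w.2 ≤ y + m} := by
  induction m with
  | zero => exact fun _ _ _ => rfl
  | succ m ih =>
    intro c c' h
    have h1 : chain c p y s m = chain c' p y s m := ih fun w hw => h w (by
      simp only [Set.mem_ofPred_eq] at hw ⊢
      push_cast
      omega)
    have h2 : level c (y + m + 1) = level c' (y + m + 1) := by
      funext z
      exact h (z, y + m + 1) (by simp [add_assoc])
    simp only [chain, h1, h2]

/-! ### Symmetry of the displacement -/

/-- The reflection of the window `[a - m, a + m]` at height `y` about its centre. -/
noncomputable def reflectWindow (a : ℤ) (m : ℕ) (y : ℤ) (w : ℤ × ℤ) : ℤ × ℤ :=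
  if w.2 = y ∧ |w.1 - a| ≤ m then (2 * a - w.1, w.2) else w

theorem reflectWindow_involutive (a : ℤ) (m : ℕ) (y : ℤ) :
    Function.Involutive (reflectWindow a m y) := by
  intro w
  by_cases h : w.2 = y ∧ |w.1 - a| ≤ m
  · have h' : |2 * a - w.1 - a| ≤ m := by
      have : 2 * a - w.1 - a = -(w.1 - a) := by ring
      rw [this, abs_neg]
      exact h.2
    rw [reflectWindow, reflectWindow, if_pos h, if_pos ⟨h.1, h'⟩]
    simp
  · rw [reflectWindow, reflectWindow, if_neg h, if_neg h]

theorem reflectWindow_of_ne {a : ℤ} {m : ℕ} {y : ℤ} {w : ℤ × ℤ} (h : w.2 ≠ y) :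
    reflectWindow a m y w = w := if_neg fun h' => h h'.1

theorem advance_reflect {p : ℝ} {ξ ξ' : ℤ → ℝ}
    (hξ' : Function.Injective ξ') {a : ℤ} {k : ℕ}
    (h : ∀ z, a - (k + 1) ≤ z → z ≤ a + (k + 1) → ξ' z = ξ (2 * a - z)) :
    (advance p ξ' (a, k)).1 = 2 * a - (advance p ξ (a, k)).1 := by
  rcases advance_cases p ξ a k with ⟨z, hz, hz1, hz2, hzp, hzm⟩ | ⟨hz, hzm⟩
  · have e : ξ' (2 * a - z) = ξ z := by
      rw [h _ (by omega) (by omega)]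
      congr 1
      ring
    rw [hz, advance_eq hξ' (z := 2 * a - z) (by omega) (by omega) (by rw [e]; exact hzp) ?_]
    intro z' h1 h2
    rw [e, h z' h1 h2]
    exact hzm _ (by omega) (by omega)
  · rcases advance_cases p ξ' a k with ⟨w, hw, hw1, hw2, hwp, hwm⟩ | ⟨hw, hwm⟩
    · rw [h w hw1 hw2] at hwp
      exact absurd hwp (not_lt.2 (hzm _ (by omega) (by omega)))
    · rw [hz, hw]
      simp only
      ring

theorem abs_advance_sub_le (p : ℝ) (ξ : ℤ → ℝ) (s : ℤ × ℕ) :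
    |(advance p ξ s).1 - s.1| ≤ s.2 + 1 := by
  obtain ⟨a, k⟩ := s
  rcases advance_cases p ξ a k with ⟨z, hz, hz1, hz2, -⟩ | ⟨hz, -⟩ <;> rw [hz] <;>
    simp only [abs_le] <;> constructor <;> omega

/-- The displacement of a path in the state `s` when the height `y` is revealed. -/
noncomputable def displacement (p : ℝ) (y : ℤ) (s : ℤ × ℕ) (c : ℤ × ℤ → ℝ) : ℝ :=
  ((advance p (level c y) s).1 : ℝ) - s.1

theorem measurable_displacement (p : ℝ) (y : ℤ) (s : ℤ × ℕ) :
    Measurable (displacement p y s) := by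
  have h : Measurable fun x : ℤ × ℕ => ((x.1 : ℝ) - s.1) := measurable_of_countable _
  exact h.comp ((measurable_advance p s).comp (measurable_level y))

theorem abs_displacement_le (p : ℝ) (y : ℤ) (s : ℤ × ℕ) (c : ℤ × ℤ → ℝ) :
    |displacement p y s c| ≤ s.2 + 1 := by
  have := abs_advance_sub_le p (level c y) s
  rw [displacement]
  exact_mod_cast this

theorem integrable_displacement (p : ℝ) (y : ℤ) (s : ℤ × ℕ) :
    Integrable (displacement p y s) fieldLaw :=
  Integrable.of_bound (measurable_displacement p y s).aestronglyMeasurable (s.2 + 1)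
    (Eventually.of_forall fun c => abs_displacement_le p y s c)

/-- The displacement is centred on every event which is invariant under the reflection of the
window, because the reflection changes its sign. -/
theorem setIntegral_displacement_eq_zero {p : ℝ} (hp0 : 0 < p) (y : ℤ) (s : ℤ × ℕ)
    {B : Set (ℤ × ℤ → ℝ)} (hB : MeasurableSet B)
    (hinv : ∀ c, (fun w => c (reflectWindow s.1 (s.2 + 1) y w)) ∈ B ↔ c ∈ B) :
    ∫ c in B, displacement p y s c ∂fieldLaw = 0 := by
  have hinj := (reflectWindow_involutive s.1 (s.2 + 1) y).injective
  have hR : Measurable fun (c : ℤ × ℤ → ℝ) w => c (reflectWindow s.1 (s.2 + 1) y w) :=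
    measurable_pi_lambda _ fun w => measurable_pi_apply _
  have hmeas := (measurable_displacement p y s).indicator hB
  have hgen := ae_generic (p := p) hp0
  have hgen' : ∀ᵐ c ∂fieldLaw,
      Generic p fun w => c (reflectWindow s.1 (s.2 + 1) y w) := by
    rw [← fieldLaw_map_comp hinj] at hgen
    exact ae_of_ae_map hR.aemeasurable hgen
  rw [← integral_indicator hB]
  have h1 : ∫ c, B.indicator (displacement p y s) c ∂fieldLaw =
      ∫ c, B.indicator (displacement p y s) (fun w => c (reflectWindow s.1 (s.2 + 1) y w))
        ∂fieldLaw := by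
    conv_lhs => rw [← fieldLaw_map_comp hinj]
    rw [integral_map hR.aemeasurable hmeas.aestronglyMeasurable]
  have h2 : ∫ c, B.indicator (displacement p y s)
      (fun w => c (reflectWindow s.1 (s.2 + 1) y w)) ∂fieldLaw =
      ∫ c, -B.indicator (displacement p y s) c ∂fieldLaw := by
    refine integral_congr_ae ?_
    filter_upwards [hgen'] with c hc'
    by_cases hcB : c ∈ B
    · rw [Set.indicator_of_mem hcB, Set.indicator_of_mem ((hinv c).2 hcB)]
      have := advance_reflect (p := p) (ξ := level c y) (a := s.1) (k := s.2) (hc'.injective y)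
        (fun z h1 h2 => by
          have : |z - s.1| ≤ (s.2 : ℤ) + 1 := by
            rw [abs_le]
            constructor <;> omega
          simp [level, reflectWindow, this])
      simp only [displacement]
      rw [this]
      push_cast
      ring
    · rw [Set.indicator_of_notMem hcB, Set.indicator_of_notMem (fun h => hcB ((hinv c).1 h)),
        neg_zero]
  rw [integral_neg] at h2
  linarith


/-! ### The relative displacement of two paths does not degenerate -/

/-- If `r` is an endpoint of the larger of two windows and does not belong to the other one, then,
with a probability of the order of the inverse size of the windows, `r` is the only site of the two
windows with a value below a small `q`. On this event the first path moves to the end of its window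
and the other displacement is still centred. -/
theorem displacement_sub_lower_of_endpoint {p : ℝ} (hp0 : 0 < p) (hp1 : p < 1) (y : ℤ) {a b r : ℤ}
    {k l : ℕ} (hr : r = a + (k + 1) ∨ r = a - (k + 1)) (hrb : ¬ |r - b| ≤ l + 1) (hlk : l ≤ k)
    {B : Set (ℤ × ℤ → ℝ)} (hB : MeasurableSet B) (hdep : DependsOn (fun c => c ∈ B) {w | w.2 < y}) :
    p * (1 - p) / 6 * fieldLaw.real B ≤
      ∫ c in B, |displacement p y (a, k) c - displacement p y (b, l) c| ∂fieldLaw := by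
  classical
  set q : ℝ := p / (6 * (k + 1)) with hq
  have hk1 : (0 : ℝ) < k + 1 := by positivity
  have hq0 : 0 < q := by positivity
  have hqk : q * (6 * (k + 1)) = p := by rw [hq]; field_simp
  have hqp : q ≤ p := by
    have : (0 : ℝ) ≤ k := Nat.cast_nonneg k
    nlinarith
  let W : Finset ℤ := (Finset.Icc (a - (k + 1)) (a + (k + 1)) ∪
    Finset.Icc (b - (l + 1)) (b + (l + 1))).erase r
  have hW : ∀ z, z ∈ W ↔ z ≠ r ∧ ((a - (k + 1) ≤ z ∧ z ≤ a + (k + 1)) ∨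
      (b - (l + 1) ≤ z ∧ z ≤ b + (l + 1))) := by
    intro z
    simp only [W, Finset.mem_erase, Finset.mem_union, Finset.mem_Icc]
  let F : Finset (ℤ × ℤ) := W.map ⟨fun z => (z, y), fun _ _ h => congrArg Prod.fst h⟩
  have hF : ∀ w, w ∈ F ↔ w.2 = y ∧ w.1 ∈ W := by
    rintro ⟨z, t⟩
    simp only [F, Finset.mem_map]
    constructor
    · rintro ⟨x, hx, h⟩; cases h; exact ⟨rfl, hx⟩
    · rintro ⟨rfl, hx⟩; exact ⟨z, hx, rfl⟩
  have hcard : F.card ≤ 6 * (k + 1) := by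
    rw [Finset.card_map]
    refine (Finset.card_erase_le).trans ((Finset.card_union_le _ _).trans ?_)
    rw [Int.card_Icc, Int.card_Icc]
    omega
  have hrF : (r, y) ∉ F := fun h => ((hW r).1 ((hF _).1 h).2).1 rfl
  set A : Set (ℤ × ℤ → ℝ) := {c | c (r, y) < q ∧ ∀ w ∈ F, q ≤ c w} with hA
  have hAm : MeasurableSet A := by
    have h : MeasurableSet {c : ℤ × ℤ → ℝ | ∀ w ∈ F, q ≤ c w} := by
      have : {c : ℤ × ℤ → ℝ | ∀ w ∈ F, q ≤ c w} = ⋂ w ∈ F, {c | q ≤ c w} := by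
        ext c; simp
      rw [this]
      exact Finset.measurableSet_biInter _ fun w _ =>
        measurableSet_le measurable_const (measurable_pi_apply w)
    exact (measurableSet_lt (measurable_pi_apply _) measurable_const).inter h
  have hAdep : DependsOn (fun c => c ∈ A) {w | w.2 = y} := by
    intro c c' h
    have h1 : c (r, y) = c' (r, y) := h _ rfl
    have h2 : ∀ w ∈ F, c w = c' w := fun w hw => h w ((hF w).1 hw).1
    simp only [hA, Set.mem_ofPred_eq, h1]
    refine propext (and_congr_right fun _ => forall₂_congr fun w hw => ?_)
    rw [h2 w hw]
  have hdisj : Disjoint {w : ℤ × ℤ | w.2 < y} {w | w.2 = y} := by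
    rw [Set.disjoint_left]
    intro w h1 h2
    exact absurd h2 (ne_of_lt h1)
  have hBA : fieldLaw.real (B ∩ A) = fieldLaw.real B * fieldLaw.real A := by
    simp only [Measure.real, fieldLaw_inter_of_dependsOn hB hAm hdisj hdep hAdep,
      ENNReal.toReal_mul]
  have hAp : q * (1 - p) ≤ fieldLaw.real A := by
    rw [Measure.real, hA, fieldLaw_lt_and_forall_le _ _ hrF hq0 (hqp.trans hp1.le),
      ENNReal.toReal_mul, ENNReal.toReal_pow, ENNReal.toReal_ofReal hq0.le,
      ENNReal.toReal_ofReal (by linarith)]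
    refine mul_le_mul_of_nonneg_left ?_ hq0.le
    have h1 := one_add_mul_le_pow (a := -q) (by linarith) F.card
    have h2 : (F.card : ℝ) ≤ 6 * (k + 1) := by exact_mod_cast hcard
    have h3 : (F.card : ℝ) * q ≤ p := by nlinarith
    calc 1 - p ≤ 1 + F.card * -q := by linarith
      _ ≤ (1 + -q) ^ F.card := h1
      _ = (1 - q) ^ F.card := by rw [← sub_eq_add_neg]
  -- the event is invariant under the reflection of the window of the second path
  have hinvol := reflectWindow_involutive b (l + 1) y
  have hRr : reflectWindow b (l + 1) y (r, y) = (r, y) := by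
    refine if_neg fun h => hrb ?_
    simpa using h.2
  have hRF : ∀ w ∈ F, reflectWindow b (l + 1) y w ∈ F := by
    intro w hw
    by_cases h : w.2 = y ∧ |w.1 - b| ≤ ((l + 1 : ℕ) : ℤ)
    · rw [reflectWindow, if_pos h, hF, hW]
      have h2 := h.2
      rw [abs_le] at h2 hrb
      push_cast at h2
      simp only
      omega
    · rw [reflectWindow, if_neg h]
      exact hw
  have hinv1 : ∀ c, c ∈ B ∩ A → (fun w => c (reflectWindow b (l + 1) y w)) ∈ B ∩ A := by
    rintro c ⟨hcB, hcA1, hcA2⟩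
    refine ⟨?_, ?_, fun w hw => hcA2 _ (hRF w hw)⟩
    · refine (iff_of_eq (hdep (x := c) (y := fun w => c (reflectWindow b (l + 1) y w)) ?_)).1 hcB
      intro w hw
      rw [reflectWindow_of_ne (ne_of_lt hw)]
    · simp only [hRr]
      exact hcA1
  have hinv : ∀ c, (fun w => c (reflectWindow b (l + 1) y w)) ∈ B ∩ A ↔ c ∈ B ∩ A := by
    intro c
    refine ⟨fun h => ?_, hinv1 c⟩
    have := hinv1 _ h
    simpa only [hinvol _] using this
  have hzero := setIntegral_displacement_eq_zero hp0 y (b, l) (hB.inter hAm) hinv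
  have hmove : ∫ c in B ∩ A, displacement p y (a, k) c ∂fieldLaw =
      ((r : ℝ) - a) * fieldLaw.real (B ∩ A) := by
    rw [mul_comm, ← smul_eq_mul, ← setIntegral_const]
    refine setIntegral_congr_ae (hB.inter hAm) ?_
    filter_upwards [ae_generic hp0] with c hc hcA
    have hmin : ∀ z', a - (k + 1) ≤ z' → z' ≤ a + (k + 1) → level c y r ≤ level c y z' := by
      intro z' h1 h2
      by_cases hz : z' = r
      · rw [hz]
      · exact (hcA.2.1.trans_le (hcA.2.2 (z', y) ((hF _).2 ⟨rfl, (hW _).2 ⟨hz, Or.inl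
          ⟨h1, h2⟩⟩⟩))).le
    rw [displacement, advance_eq (hc.injective y) (z := r) (by omega) (by omega)
      (hcA.2.1.trans_le hqp) hmin]
  have hi1 := integrable_displacement p y (a, k)
  have hi2 := integrable_displacement p y (b, l)
  have hi : Integrable (fun c => displacement p y (a, k) c - displacement p y (b, l) c) fieldLaw :=
    hi1.sub hi2
  have hra : |(r : ℝ) - a| = k + 1 := by
    rcases hr with rfl | rfl
    · push_cast
      rw [add_sub_cancel_left, abs_of_pos hk1]
    · push_cast
      rw [sub_sub_cancel_left, abs_neg, abs_of_pos hk1]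
  calc p * (1 - p) / 6 * fieldLaw.real B
      = (k + 1) * (fieldLaw.real B * (q * (1 - p))) := by rw [← hqk]; ring
    _ ≤ (k + 1) * (fieldLaw.real B * fieldLaw.real A) := by gcongr
    _ = |∫ c in B ∩ A, (displacement p y (a, k) c - displacement p y (b, l) c) ∂fieldLaw| := by
        rw [integral_sub hi1.integrableOn hi2.integrableOn, hzero, hmove, sub_zero, abs_mul, hra,
          hBA, abs_of_nonneg (by positivity)]
    _ ≤ ∫ c in B ∩ A, |displacement p y (a, k) c - displacement p y (b, l) c| ∂fieldLaw :=
        abs_integral_le_integral_abs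
    _ ≤ ∫ c in B, |displacement p y (a, k) c - displacement p y (b, l) c| ∂fieldLaw :=
        setIntegral_mono_set hi.abs.integrableOn (Eventually.of_forall fun c => abs_nonneg _)
          (Eventually.of_forall fun c hc => hc.1)

/-- Uniformly in the states, distinct paths have a nondegenerate relative displacement on every event
of the past: of two ordered windows, the larger one has an endpoint outside the other. -/
theorem displacement_sub_lower {p : ℝ} (hp0 : 0 < p) (hp1 : p < 1) (y : ℤ) {s s' : ℤ × ℕ}
    (hss : Before s s') (hne : s ≠ s') {B : Set (ℤ × ℤ → ℝ)} (hB : MeasurableSet B)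
    (hdep : DependsOn (fun c => c ∈ B) {w | w.2 < y}) :
    p * (1 - p) / 6 * fieldLaw.real B ≤
      ∫ c in B, |displacement p y s' c - displacement p y s c| ∂fieldLaw := by
  obtain ⟨a, k⟩ := s
  obtain ⟨b, l⟩ := s'
  have h := hss.resolve_left hne
  simp only at h
  have h1 := le_abs_self ((k : ℤ) - l)
  have h2 := neg_le_abs ((k : ℤ) - l)
  rcases le_total k l with hkl | hkl
  · exact displacement_sub_lower_of_endpoint hp0 hp1 y (Or.inl rfl) (by rw [abs_le]; omega)
      hkl hB hdep
  · simp only [abs_sub_comm (displacement p y (b, l) _)]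
    exact displacement_sub_lower_of_endpoint hp0 hp1 y (Or.inr rfl) (by rw [abs_le]; omega)
      hkl hB hdep

/-! ### The gap between two paths -/

/-- The distance of the last vertices of two paths at height `y + m`. -/
noncomputable def gap (p : ℝ) (y : ℤ) (s s' : ℤ × ℕ) (m : ℕ) (c : ℤ × ℤ → ℝ) : ℝ :=
  ((chain c p y s' m).1 : ℝ) - (chain c p y s m).1

theorem abs_chain_sub_le (c : ℤ × ℤ → ℝ) (p : ℝ) (y : ℤ) (s : ℤ × ℕ) (m : ℕ) :
    |(chain c p y s m).1 - s.1| ≤ m * (s.2 + m) := by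
  induction m with
  | zero => simp [chain]
  | succ m ih =>
    have h1 := abs_advance_sub_le p (level c (y + m + 1)) (chain c p y s m)
    have h2 : ((chain c p y s m).2 : ℤ) ≤ s.2 + m := by exact_mod_cast age_chain_le c p y s m
    have h3 := abs_sub_le (chain c p y s (m + 1)).1 (chain c p y s m).1 s.1
    rw [chain] at h3 ⊢
    have h4 : (0 : ℤ) ≤ m := Int.natCast_nonneg m
    push_cast
    nlinarith

theorem abs_gap_le (p : ℝ) (y : ℤ) (s s' : ℤ × ℕ) (m : ℕ) (c : ℤ × ℤ → ℝ) :
    |gap p y s s' m c| ≤ |(s'.1 : ℝ) - s.1| + m * (s'.2 + m) + m * (s.2 + m) := by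
  have h1 : |((chain c p y s m).1 : ℝ) - s.1| ≤ m * (s.2 + m) := by
    exact_mod_cast abs_chain_sub_le c p y s m
  have h2 : |((chain c p y s' m).1 : ℝ) - s'.1| ≤ m * (s'.2 + m) := by
    exact_mod_cast abs_chain_sub_le c p y s' m
  have h3 : gap p y s s' m c = ((s'.1 : ℝ) - s.1) + ((chain c p y s' m).1 - s'.1) -
      ((chain c p y s m).1 - s.1) := by
    rw [gap]; ring
  rw [h3]
  exact (abs_sub _ _).trans (add_le_add ((abs_add_le _ _).trans (add_le_add le_rfl h2)) h1)

theorem measurable_gap (p : ℝ) (y : ℤ) (s s' : ℤ × ℕ) (m : ℕ) : Measurable (gap p y s s' m) := by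
  have h : Measurable fun x : ℤ × ℕ => (x.1 : ℝ) := measurable_of_countable _
  exact (h.comp (measurable_chain p y s' m)).sub (h.comp (measurable_chain p y s m))

theorem integrable_gap (p : ℝ) (y : ℤ) (s s' : ℤ × ℕ) (m : ℕ) :
    Integrable (gap p y s s' m) fieldLaw :=
  Integrable.of_bound (measurable_gap p y s s' m).aestronglyMeasurable _
    (Eventually.of_forall fun c => abs_gap_le p y s s' m c)

theorem ae_gap_nonneg {p : ℝ} (hp0 : 0 < p) {s s' : ℤ × ℕ} (hss : Before s s') (y : ℤ) (m : ℕ) :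
    ∀ᵐ c ∂fieldLaw, 0 ≤ gap p y s s' m c := by
  filter_upwards [ae_generic hp0] with c hc
  have : ((chain c p y s m).1 : ℝ) ≤ (chain c p y s' m).1 := by
    exact_mod_cast (hss.chain hc y m).le
  exact sub_nonneg.2 this

theorem integral_nonpos_of_fibers {α : Type*} [Countable α] {X : (ℤ × ℤ → ℝ) → α}
    (hX : ∀ s, MeasurableSet (X ⁻¹' {s})) {f : (ℤ × ℤ → ℝ) → ℝ} (hf : Integrable f fieldLaw)
    (h : ∀ s, ∫ c in X ⁻¹' {s}, f c ∂fieldLaw ≤ 0) : ∫ c, f c ∂fieldLaw ≤ 0 := by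
  have hd : Pairwise (Function.onFun Disjoint fun s => X ⁻¹' {s}) := by
    intro s s' hs
    exact Disjoint.preimage X (by simpa using hs)
  have h1 := integral_iUnion (μ := fieldLaw) hX hd hf.integrableOn
  have h2 : (⋃ s, X ⁻¹' {s}) = Set.univ := by
    ext c; simp
  rw [h2, setIntegral_univ] at h1
  rw [h1]
  exact tsum_nonpos h

/-- The pair of states of two chains. -/
noncomputable def chainPair (p : ℝ) (y : ℤ) (s s' : ℤ × ℕ) (m : ℕ) (c : ℤ × ℤ → ℝ) :
    (ℤ × ℕ) × (ℤ × ℕ) := (chain c p y s m, chain c p y s' m)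

theorem measurableSet_chainPair_fiber (p : ℝ) (y : ℤ) (s s' : ℤ × ℕ) (m : ℕ)
    (x : (ℤ × ℕ) × (ℤ × ℕ)) : MeasurableSet (chainPair p y s s' m ⁻¹' {x}) :=
  ((measurable_chain p y s m).prodMk (measurable_chain p y s' m)) (measurableSet_singleton x)

theorem dependsOn_chainPair_fiber (p : ℝ) (y : ℤ) (s s' : ℤ × ℕ) (m : ℕ)
    (x : (ℤ × ℕ) × (ℤ × ℕ)) :
    DependsOn (fun c => c ∈ chainPair p y s s' m ⁻¹' {x}) {w | w.2 < y + m + 1} := by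
  intro c c' h
  have h' : ∀ w ∈ {w : ℤ × ℤ | w.2 ≤ y + m}, c w = c' w := fun w hw =>
    h w (Int.lt_add_one_of_le hw)
  simp only [chainPair, Set.mem_preimage, Set.mem_singleton_iff,
    dependsOn_chain p y s m h', dependsOn_chain p y s' m h']

theorem gap_of_mem_fiber {p : ℝ} {y : ℤ} {s s' : ℤ × ℕ} {m : ℕ} {x : (ℤ × ℕ) × (ℤ × ℕ)}
    {c : ℤ × ℤ → ℝ} (hc : c ∈ chainPair p y s s' m ⁻¹' {x}) :
    gap p y s s' m c = (x.2.1 : ℝ) - x.1.1 := by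
  have hc : chainPair p y s s' m c = x := hc
  rw [← hc]
  rfl

theorem gap_succ_of_mem_fiber {p : ℝ} {y : ℤ} {s s' : ℤ × ℕ} {m : ℕ} {x : (ℤ × ℕ) × (ℤ × ℕ)}
    {c : ℤ × ℤ → ℝ} (hc : c ∈ chainPair p y s s' m ⁻¹' {x}) :
    gap p y s s' (m + 1) c = ((x.2.1 : ℝ) - x.1.1) +
      (displacement p (y + m + 1) x.2 c - displacement p (y + m + 1) x.1 c) := by
  have hc : chainPair p y s s' m c = x := hc
  rw [← hc]
  simp only [gap, chainPair, displacement, chain]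
  ring

/-- On each fibre of the past, the relative displacement is centred. -/
theorem setIntegral_displacement_sub_eq_zero {p : ℝ} (hp0 : 0 < p) (y : ℤ) (t t' : ℤ × ℕ)
    {B : Set (ℤ × ℤ → ℝ)} (hB : MeasurableSet B)
    (hdep : DependsOn (fun c => c ∈ B) {w | w.2 < y}) :
    ∫ c in B, (displacement p y t' c - displacement p y t c) ∂fieldLaw = 0 := by
  have h0 : ∀ t : ℤ × ℕ, ∫ c in B, displacement p y t c ∂fieldLaw = 0 := fun t => by
    refine setIntegral_displacement_eq_zero hp0 y t hB fun c => iff_of_eq (hdep fun w hw => ?_)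
    rw [reflectWindow_of_ne (ne_of_lt hw)]
  rw [integral_sub (integrable_displacement p y t').integrableOn
    (integrable_displacement p y t).integrableOn, h0, h0, sub_zero]

/-- The gap is a martingale; only the constancy of its mean is needed. -/
theorem integral_gap {p : ℝ} (hp0 : 0 < p) (y : ℤ) (s s' : ℤ × ℕ) (m : ℕ) :
    ∫ c, gap p y s s' m c ∂fieldLaw = (s'.1 : ℝ) - s.1 := by
  induction m with
  | zero => simp [gap, chain]
  | succ m ih =>
    have hi := (integrable_gap p y s s' (m + 1)).sub (integrable_gap p y s s' m)
    have hfib : ∀ x, ∫ c in chainPair p y s s' m ⁻¹' {x},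
        (gap p y s s' (m + 1) - gap p y s s' m) c ∂fieldLaw = 0 := by
      intro x
      rw [← setIntegral_displacement_sub_eq_zero hp0 (y + m + 1) x.1 x.2
        (measurableSet_chainPair_fiber p y s s' m x) (dependsOn_chainPair_fiber p y s s' m x)]
      refine setIntegral_congr_fun (measurableSet_chainPair_fiber p y s s' m x) fun c hc => ?_
      simp only [Pi.sub_apply, gap_of_mem_fiber hc, gap_succ_of_mem_fiber hc]
      ring
    have h1 := integral_nonpos_of_fibers (measurableSet_chainPair_fiber p y s s' m) hi
      fun x => (hfib x).le
    have h2 := integral_nonpos_of_fibers (measurableSet_chainPair_fiber p y s s' m) hi.neg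
      fun x => by
        simp only [Pi.neg_apply]
        rw [integral_neg, hfib x, neg_zero]
    simp only [Pi.neg_apply, integral_neg] at h2
    simp only [Pi.sub_apply] at h1 h2
    rw [integral_sub (integrable_gap p y s s' (m + 1)) (integrable_gap p y s s' m)] at h1 h2
    linarith

/-! ### The concave potential and the decay of the coalescence probability -/

/-- A concave function which is strictly concave exactly on `(-∞, K]`. -/
noncomputable def potential (K d : ℝ) : ℝ := K ^ 2 - max (K - d) 0 ^ 2

theorem potential_le (K d : ℝ) : potential K d ≤ K ^ 2 := by
  unfold potential
  have := sq_nonneg (max (K - d) 0)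
  linarith

theorem potential_of_le {K d : ℝ} (h : K ≤ d) : potential K d = K ^ 2 := by
  simp [potential, max_eq_right (sub_nonpos.2 h)]

theorem potential_nonneg {K d : ℝ} (hK : 0 ≤ K) (hd : 0 ≤ d) : 0 ≤ potential K d := by
  unfold potential
  have h1 : max (K - d) 0 ≤ K := max_le (by linarith) hK
  have h2 : 0 ≤ max (K - d) 0 := le_max_right _ _
  nlinarith

theorem potential_le_mul {K d : ℝ} (hK : 0 ≤ K) : potential K d ≤ 2 * K * d := by
  rcases le_total d K with h | h
  · unfold potential
    rw [max_eq_left (sub_nonneg.2 h)]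
    nlinarith [sq_nonneg d]
  · rw [potential_of_le h]
    nlinarith

theorem continuous_potential (K : ℝ) : Continuous (potential K) := by
  unfold potential
  fun_prop

/-- Strict concavity bounds the change of the potential in an integer step; the term linear in the
step disappears on taking expectations. -/
theorem potential_add_le {K d x : ℝ} (hd : d ≤ K) (hx : |x| ≤ x ^ 2) :
    potential K (d + x) ≤ potential K d + (2 * (K - d) + 1 / 2) * x - 1 / 2 * |x| := by
  unfold potential
  rw [max_eq_left (sub_nonneg.2 hd)]
  rcases le_total 0 x with h0 | h0
  · rw [abs_of_nonneg h0]
    rcases le_total (K - (d + x)) 0 with h1 | h1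
    · rw [max_eq_right h1]
      nlinarith
    · rw [max_eq_left h1]
      nlinarith
  · rw [abs_of_nonpos h0] at hx ⊢
    rw [max_eq_left (by linarith)]
    nlinarith

theorem integrable_potential_gap (K p : ℝ) (y : ℤ) (s s' : ℤ × ℕ) (m : ℕ) :
    Integrable (fun c => potential K (gap p y s s' m c)) fieldLaw := by
  set C := |(s'.1 : ℝ) - s.1| + m * (s'.2 + m) + m * (s.2 + m)
  refine Integrable.of_bound ((continuous_potential K).measurable.comp
    (measurable_gap p y s s' m)).aestronglyMeasurable (K ^ 2 + (|K| + C) ^ 2)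
    (Eventually.of_forall fun c => ?_)
  have h1 := abs_gap_le p y s s' m c
  have h2 : |max (K - gap p y s s' m c) 0| ≤ |K| + C := by
    rw [abs_of_nonneg (le_max_right _ _)]
    refine max_le ?_ (add_nonneg (abs_nonneg K) ((abs_nonneg _).trans h1))
    have := le_abs_self K
    have := neg_le_abs (gap p y s s' m c)
    linarith
  have h3 : max (K - gap p y s s' m c) 0 ^ 2 ≤ (|K| + C) ^ 2 := sq_le_sq' (by
    have := neg_abs_le (max (K - gap p y s s' m c) 0); linarith) ((le_abs_self _).trans h2)
  rw [Real.norm_eq_abs, potential, abs_le]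
  have h4 := sq_nonneg (max (K - gap p y s s' m c) 0)
  have h5 := sq_nonneg K
  constructor <;> nlinarith

/-- One level decreases the mean potential by a constant times the probability that the paths are
distinct and closer than `K`. -/
theorem integral_potential_gap_succ {p : ℝ} (hp0 : 0 < p) (hp1 : p < 1) {s s' : ℤ × ℕ}
    (hss : Before s s') (y : ℤ) (m : ℕ) (K : ℝ) :
    ∫ c, potential K (gap p y s s' (m + 1) c) ∂fieldLaw +
        p * (1 - p) / 12 * fieldLaw.real {c | 0 < gap p y s s' m c ∧ gap p y s s' m c < K} ≤
      ∫ c, potential K (gap p y s s' m c) ∂fieldLaw := by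
  set E : Set (ℤ × ℤ → ℝ) := {c | 0 < gap p y s s' m c ∧ gap p y s s' m c < K} with hE
  have hgm := measurable_gap p y s s' m
  have hEm : MeasurableSet E :=
    (measurableSet_lt measurable_const hgm).inter (measurableSet_lt hgm measurable_const)
  have hi0 := integrable_potential_gap K p y s s' m
  have hi1 := integrable_potential_gap K p y s s' (m + 1)
  have hi2 : Integrable (E.indicator fun _ => p * (1 - p) / 12) fieldLaw :=
    (integrable_const _).indicator hEm
  have hi01 : Integrable (fun c => potential K (gap p y s s' (m + 1) c) -
      potential K (gap p y s s' m c)) fieldLaw := hi1.sub hi0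
  have hi012 : Integrable (fun c => potential K (gap p y s s' (m + 1) c) -
      potential K (gap p y s s' m c) + E.indicator (fun _ => p * (1 - p) / 12) c) fieldLaw :=
    hi01.add hi2
  have hmain := integral_nonpos_of_fibers (measurableSet_chainPair_fiber p y s s' m)
    hi012 fun x => by
      set B := chainPair p y s s' m ⁻¹' {x} with hBdef
      have hBm : MeasurableSet B := measurableSet_chainPair_fiber p y s s' m x
      have hdep := dependsOn_chainPair_fiber p y s s' m x
      by_cases hx : Before x.1 x.2
      swap
      · -- the other fibres are null
        have h0 : fieldLaw B = 0 := by
          refine measure_mono_null (t := {c | ¬ Generic p c}) ?_ (ae_iff.1 (ae_generic hp0))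
          intro c hc hgen
          have hc : chainPair p y s s' m c = x := hc
          exact hx (hc ▸ hss.chain hgen y m)
        rw [Measure.restrict_eq_zero.2 h0, integral_zero_measure]
      set d : ℝ := (x.2.1 : ℝ) - x.1.1 with hd
      have hg0 : ∀ c ∈ B, gap p y s s' m c = d := fun c hc => gap_of_mem_fiber hc
      set Δ : (ℤ × ℤ → ℝ) → ℝ := fun c =>
        displacement p (y + m + 1) x.2 c - displacement p (y + m + 1) x.1 c with hΔ
      have hg1 : ∀ c ∈ B, gap p y s s' (m + 1) c = d + Δ c := fun c hc => gap_succ_of_mem_fiber hc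
      by_cases hne : x.1 = x.2
      · -- coalesced paths stay together
        refine le_of_eq (setIntegral_eq_zero_of_forall_eq_zero fun c hc => ?_)
        have e0 : d = 0 := by rw [hd, hne, sub_self]
        have e1 : Δ c = 0 := by rw [hΔ]; simp only [hne, sub_self]
        have e2 : c ∉ E := fun h => by
          have := h.1
          rw [hg0 c hc, e0] at this
          exact lt_irrefl _ this
        simp [hg0 c hc, hg1 c hc, e1, Set.indicator_of_notMem e2]
      have hd0 : 0 < d := by
        have h1 := hx.resolve_left hne
        have h2 := abs_nonneg ((x.1.2 : ℤ) - x.2.2)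
        have h3 : x.1.1 < x.2.1 := by omega
        have h4 : (x.1.1 : ℝ) < x.2.1 := by exact_mod_cast h3
        exact sub_pos.2 h4
      rcases le_or_gt K d with hKd | hKd
      · refine setIntegral_nonpos hBm fun c hc => ?_
        have e2 : c ∉ E := fun h => by
          have := h.2
          rw [hg0 c hc] at this
          exact absurd this (not_lt.2 hKd)
        simp only [hg0 c hc, hg1 c hc, Set.indicator_of_notMem e2,
          potential_of_le hKd]
        have := potential_le K (d + Δ c)
        linarith
      · have hiΔ : Integrable Δ fieldLaw :=
          (integrable_displacement _ _ _).sub (integrable_displacement _ _ _)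
        have hiA : Integrable (fun c => (2 * (K - d) + 1 / 2) * Δ c - 1 / 2 * |Δ c|) fieldLaw :=
          (hiΔ.const_mul _).sub (hiΔ.abs.const_mul _)
        have hiB : Integrable (fun c => (2 * (K - d) + 1 / 2) * Δ c - 1 / 2 * |Δ c| +
            p * (1 - p) / 12) fieldLaw := hiA.add (integrable_const _)
        have hle : ∀ c ∈ B, potential K (gap p y s s' (m + 1) c) - potential K (gap p y s s' m c) +
            E.indicator (fun _ => p * (1 - p) / 12) c ≤
            (2 * (K - d) + 1 / 2) * Δ c - 1 / 2 * |Δ c| + p * (1 - p) / 12 := by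
          intro c hc
          have hcE : c ∈ E := by
            rw [hE, Set.mem_ofPred_eq, hg0 c hc]
            exact ⟨hd0, hKd⟩
          simp only [hg0 c hc, hg1 c hc, Set.indicator_of_mem hcE]
          have hint : |Δ c| ≤ Δ c ^ 2 := by
            obtain ⟨n, hn⟩ : ∃ n : ℤ, Δ c = n :=
              ⟨((advance p (level c (y + m + 1)) x.2).1 - x.2.1) -
                ((advance p (level c (y + m + 1)) x.1).1 - x.1.1), by
                  simp only [hΔ, displacement]; push_cast; ring⟩
            rw [hn]
            have hn2 : |n| ≤ n ^ 2 := by rw [← sq_abs]; exact Int.le_self_sq _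
            exact_mod_cast hn2
          have := potential_add_le hKd.le hint
          linarith
        refine (setIntegral_mono_on hi012.integrableOn hiB.integrableOn hBm hle).trans ?_
        have e1 : ∫ c in B, ((2 * (K - d) + 1 / 2) * Δ c - 1 / 2 * |Δ c| + p * (1 - p) / 12)
            ∂fieldLaw = (2 * (K - d) + 1 / 2) * ∫ c in B, Δ c ∂fieldLaw -
              1 / 2 * ∫ c in B, |Δ c| ∂fieldLaw + fieldLaw.real B * (p * (1 - p) / 12) := by
          rw [integral_add hiA.integrableOn
            (integrable_const _).integrableOn, integral_sub (hiΔ.const_mul _).integrableOn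
            (hiΔ.abs.const_mul _).integrableOn, integral_const_mul, integral_const_mul,
            setIntegral_const, smul_eq_mul]
        rw [e1, hΔ, setIntegral_displacement_sub_eq_zero hp0 _ _ _ hBm hdep]
        have := displacement_sub_lower hp0 hp1 (y + m + 1) hx hne hBm hdep
        linarith
  rw [integral_add hi01 hi2, integral_sub hi1 hi0, integral_indicator hEm, setIntegral_const,
    smul_eq_mul] at hmain
  linarith

/-- The probability that two paths have not coalesced after `m` levels. -/
theorem chain_ne_le {p : ℝ} (hp0 : 0 < p) (hp1 : p < 1) {s s' : ℤ × ℕ} (hss : Before s s')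
    (y : ℤ) {m : ℕ} (hm : 1 ≤ m) :
    fieldLaw.real {c | chain c p y s m ≠ chain c p y s' m} ≤
      (24 / (p * (1 - p)) + 1) * ((s'.1 : ℝ) - s.1) / √m := by
  set κ : ℝ := p * (1 - p) / 12 with hκ
  have hκ0 : 0 < κ := by
    have : 0 < 1 - p := by linarith
    positivity
  set x : ℝ := (s'.1 : ℝ) - s.1 with hx
  set K : ℝ := √m with hK
  have hm0 : (0 : ℝ) < m := by exact_mod_cast hm
  have hK0 : 0 < K := Real.sqrt_pos.2 hm0
  have hKm : K * K = m := Real.mul_self_sqrt hm0.le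
  set e : ℕ → ℝ := fun j => fieldLaw.real {c | 0 < gap p y s s' j c ∧ gap p y s s' j c < K} with he
  set f : ℕ → ℝ := fun j => fieldLaw.real {c | chain c p y s j ≠ chain c p y s' j} with hf
  -- summing the one-step estimate
  have hsum : ∀ n : ℕ, ∫ c, potential K (gap p y s s' n c) ∂fieldLaw +
      κ * ∑ j ∈ Finset.range n, e j ≤ 2 * K * x := by
    intro n
    induction n with
    | zero =>
      have : ∀ c, gap p y s s' 0 c = x := fun c => rfl
      simp only [this, integral_const, probReal_univ, one_smul, Finset.range_zero,
        Finset.sum_empty, mul_zero, add_zero]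
      exact potential_le_mul hK0.le
    | succ n ih =>
      have := integral_potential_gap_succ hp0 hp1 hss y n K
      rw [← hκ] at this
      rw [Finset.sum_range_succ, mul_add]
      simp only [he] at ih ⊢
      linarith
  have h1 : κ * ∑ j ∈ Finset.range m, e j ≤ 2 * K * x := by
    have h2 : 0 ≤ ∫ c, potential K (gap p y s s' m c) ∂fieldLaw :=
      integral_nonneg_of_ae ((ae_gap_nonneg hp0 hss y m).mono fun c hc =>
        potential_nonneg hK0.le hc)
    linarith [hsum m]
  -- non-coalesced paths at a distance at least `K` are controlled by the mean of the gap
  have h2 : ∀ j, f j ≤ e j + x / K := by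
    intro j
    have hmk := mul_meas_ge_le_integral_of_nonneg (μ := fieldLaw) (ae_gap_nonneg hp0 hss y j)
      (integrable_gap p y s s' j) K
    rw [integral_gap hp0] at hmk
    have hmk' : fieldLaw.real {c | K ≤ gap p y s s' j c} ≤ x / K := by
      rw [le_div_iff₀ hK0, mul_comm]
      exact hmk
    refine le_trans ?_ (add_le_add le_rfl hmk')
    refine le_trans ?_ (measureReal_union_le _ _)
    refine ENNReal.toReal_mono (measure_ne_top _ _) (measure_mono_ae ?_)
    filter_upwards [ae_generic hp0] with c hc hcne
    rcases lt_or_ge (gap p y s s' j c) K with hlt | hge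
    · refine Or.inl ⟨?_, hlt⟩
      by_contra h0
      have h3 : ((chain c p y s' j).1 : ℝ) ≤ (chain c p y s j).1 := sub_nonpos.1 (not_lt.1 h0)
      exact hcne ((hss.chain hc y j).eq_of_fst (by exact_mod_cast h3))
    · exact Or.inr hge
  have hanti : ∀ j, f (j + 1) ≤ f j := by
    intro j
    refine measureReal_mono (fun c hc h => hc ?_)
    simp only [chain, h]
  have hanti' : Antitone f := antitone_nat_of_succ_le hanti
  have h3 : m * f m ≤ ∑ j ∈ Finset.range m, f j := by
    have := Finset.card_nsmul_le_sum (Finset.range m) f (f m) fun j hj =>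
      hanti' (Finset.mem_range.1 hj).le
    simpa using this
  have h4 : ∑ j ∈ Finset.range m, f j ≤ ∑ j ∈ Finset.range m, e j + m * (x / K) := by
    refine (Finset.sum_le_sum fun j _ => h2 j).trans ?_
    rw [Finset.sum_add_distrib]
    simp
  have h5 : ∑ j ∈ Finset.range m, e j ≤ 2 * K * x / κ := by
    rw [le_div_iff₀ hκ0, mul_comm]
    exact h1
  have h6 : m * f m ≤ 2 * K * x / κ + m * (x / K) := by linarith
  change f m ≤ _
  have h7 : 24 / (p * (1 - p)) = 2 / κ := by
    rw [hκ]
    have : (1 - p) ≠ 0 := by linarith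
    field_simp
    norm_num
  rw [h7, le_div_iff₀ hK0]
  have h8 : m * (x / K) = K * x := by rw [← hKm]; field_simp
  rw [h8, ← hKm] at h6
  have h9 : K * (f m * K) ≤ K * ((2 / κ + 1) * x) := by
    calc K * (f m * K) = K * K * f m := by ring
      _ ≤ 2 * K * x / κ + K * x := h6
      _ = K * ((2 / κ + 1) * x) := by ring
  exact le_of_mul_le_mul_left h9 hK0


/-! ### The tails of the coalescence time -/

/-- The constant of the estimate `chain_ne_le`. -/
noncomputable def decayConst (p : ℝ) : ℝ := 24 / (p * (1 - p)) + 1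

theorem one_le_decayConst {p : ℝ} (hp0 : 0 < p) (hp1 : p < 1) : 1 ≤ decayConst p := by
  have : 0 < 1 - p := by linarith
  have : 0 ≤ 24 / (p * (1 - p)) := by positivity
  rw [decayConst]
  linarith

theorem exists_chain_ne_le {p : ℝ} (hp0 : 0 < p) (hp1 : p < 1) {x : ℕ} (hx : 1 ≤ x) {t : ℝ}
    (ht : 0 < t) : ∃ h : ℕ, (h : ℝ) < t ∧
      fieldLaw {c | chain c p 0 (0, 0) h ≠ chain c p 0 ((x : ℤ), 0) h} ≤
        ENNReal.ofReal (2 * decayConst p * x / √t) := by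
  have hC := one_le_decayConst hp0 hp1
  have hx1 : (1 : ℝ) ≤ x := by exact_mod_cast hx
  have hst : 0 < √t := Real.sqrt_pos.2 ht
  rcases le_or_gt t 2 with h2 | h2
  · refine ⟨0, by exact_mod_cast ht, prob_le_one.trans ?_⟩
    rw [ENNReal.one_le_ofReal, le_div_iff₀ hst]
    have : √t ≤ 2 := Real.sqrt_le_iff.2 ⟨by norm_num, by linarith⟩
    nlinarith
  · have hceil := Nat.ceil_lt_add_one ht.le
    have hceil' := Nat.le_ceil t
    have hc1 : 1 ≤ ⌈t⌉₊ := Nat.one_le_ceil_iff.2 ht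
    refine ⟨⌈t⌉₊ - 1, ?_, ?_⟩
    · rw [Nat.cast_sub hc1]
      push_cast
      linarith
    set h := ⌈t⌉₊ - 1 with hh
    have hht : t - 1 ≤ h := by
      rw [hh, Nat.cast_sub hc1]
      push_cast
      linarith
    have hh0 : (1 : ℝ) < h := by linarith
    have hh1 : 1 ≤ h := by
      have : 1 < h := by exact_mod_cast hh0
      exact this.le
    have hss : Before (0, 0) ((x : ℤ), 0) := by
      right
      simp only [sub_self, abs_zero]
      omega
    have hsq : √t / 2 ≤ √h := by
      have e : √t / 2 = √(t / 4) := by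
        rw [Real.sqrt_div' _ (by norm_num : (0 : ℝ) ≤ 4)]
        congr 1
        rw [show (4 : ℝ) = 2 ^ 2 by norm_num, Real.sqrt_sq (by norm_num)]
      rw [e]
      exact Real.sqrt_le_sqrt (by linarith)
    rw [← ENNReal.ofReal_toReal (measure_ne_top fieldLaw _)]
    refine ENNReal.ofReal_le_ofReal ((chain_ne_le hp0 hp1 hss 0 hh1).trans ?_)
    simp only [Int.cast_natCast, Int.cast_zero, sub_zero]
    rw [← decayConst]
    calc decayConst p * x / √h ≤ decayConst p * x / (√t / 2) := by gcongr
      _ = 2 * decayConst p * x / √t := by field_simp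

theorem fieldLaw_coal_le {p : ℝ} (hp0 : 0 < p) (hp1 : p < 1) {x : ℕ} (hx : 1 ≤ x) {t : ℝ}
    (ht : 0 < t) :
    fieldLaw {c | ENNReal.ofReal t < ((coalSteps c p ((x : ℤ), 0) (0, 0) : ℕ∞) : ℝ≥0∞) ∨
      (t : EReal) ≤ coalHeight c p ((x : ℤ), 0) (0, 0)} ≤
        ENNReal.ofReal (2 * decayConst p * x / √t) := by
  obtain ⟨h, hht, hle⟩ := exists_chain_ne_le hp0 hp1 hx ht
  refine le_trans (measure_mono_ae ?_) hle
  filter_upwards [ae_generic hp0] with c hc hcE heq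
  obtain ⟨h1, h2⟩ := hc.coal_le (a := x) (b := 0) (y := 0) (by omega) heq.symm
  rcases hcE with hE | hE
  · have h3 : ((coalSteps c p ((x : ℤ), 0) (0, 0) : ℕ∞) : ℝ≥0∞) ≤ ((h : ℕ∞) : ℝ≥0∞) := by
      exact_mod_cast h1
    have h4 : ENNReal.ofReal t < ((h : ℕ∞) : ℝ≥0∞) := lt_of_lt_of_le hE h3
    rw [ENat.toENNReal_coe, ← ENNReal.ofReal_natCast, ENNReal.ofReal_lt_ofReal_iff_of_nonneg
      ht.le] at h4
    exact absurd hht (not_lt.2 h4.le)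
  · exact absurd (EReal.coe_lt_coe_iff.2 hht) (not_lt.2 (hE.trans h2))

/-! ### Passing to the closure -/

theorem strictMono_tanh : StrictMono Real.tanh := by
  intro x y hxy
  rw [Real.tanh_eq_sinh_div_cosh, Real.tanh_eq_sinh_div_cosh, div_lt_div_iff₀ (Real.cosh_pos x)
    (Real.cosh_pos y)]
  have h := Real.sinh_sub y x
  have h2 : 0 < Real.sinh (y - x) := Real.sinh_pos_iff.2 (sub_pos.2 hxy)
  linarith

theorem strictMono_tanhE : StrictMono tanhE := by
  intro x y hxy
  induction x with
  | top => exact absurd hxy not_top_lt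
  | bot =>
    induction y with
    | bot => exact absurd hxy (lt_irrefl _)
    | top => simp [tanhE]
    | coe y =>
      rw [tanhE_coe]
      simpa [tanhE] using Real.neg_one_lt_tanh y
  | coe x =>
    induction y with
    | bot => exact absurd hxy not_lt_bot
    | top =>
      rw [tanhE_coe]
      simpa [tanhE] using Real.tanh_lt_one x
    | coe y =>
      rw [tanhE_coe, tanhE_coe]
      exact strictMono_tanh (EReal.coe_lt_coe_iff.1 hxy)

theorem abs_tanhStar_le (x : Option EReal) : |tanhStar x| ≤ 1 := by
  cases x with
  | none => simp [tanhStar]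
  | some x => exact abs_tanhE_le x

theorem abs_weight_le (t : EReal) : |weight t| ≤ 1 := by
  unfold weight
  split_ifs
  · simp
  · rw [abs_of_nonneg (by positivity)]
    exact div_le_one_of_le₀ (by linarith [abs_nonneg t.toReal]) (by positivity)

theorem start_le_pathDist (π₁ π₂ : WebPath) :
    |tanhE π₁.start - tanhE π₂.start| ≤ pathDist π₁ π₂ := le_max_left _ _

theorem value_le_pathDist {π₁ π₂ : WebPath} {t : ℝ} (h1 : π₁.start ≤ t) (h2 : π₂.start ≤ t) :
    |tanhStar (π₁.toFun t) - tanhStar (π₂.toFun t)| * weight t ≤ pathDist π₁ π₂ := by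
  have hb : BddAbove (Set.range fun t : Set.Icc (min π₁.start π₂.start) (⊤ : EReal) =>
      |tanhStar (π₁.toFun (max t π₁.start)) * weight t -
        tanhStar (π₂.toFun (max t π₂.start)) * weight t|) := by
    refine ⟨2, ?_⟩
    rintro _ ⟨t, rfl⟩
    refine (abs_sub _ _).trans ?_
    rw [abs_mul, abs_mul]
    have := mul_le_one₀ (abs_tanhStar_le (π₁.toFun (max t π₁.start))) (abs_nonneg _)
      (abs_weight_le t)
    have := mul_le_one₀ (abs_tanhStar_le (π₂.toFun (max t π₂.start))) (abs_nonneg _)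
      (abs_weight_le t)
    linarith
  have h := le_ciSup hb ⟨(t : EReal), min_le_of_left_le h1, le_top⟩
  simp only [max_eq_left h1, max_eq_left h2] at h
  have hw : 0 ≤ weight t := by rw [weight_coe]; positivity
  rw [← sub_mul, abs_mul, abs_of_nonneg hw] at h
  exact h.trans (le_max_right _ _)

theorem scaledPath_toFun (c : ℤ × ℤ → ℝ) (p σ γ : ℝ) (n : ℕ) (u : ℤ × ℤ) (t : ℝ) :
    (scaledPath c p σ γ n u).toFun t =
      some ((graphPath c p u ((n : ℝ) ^ 2 * γ * t) / ((n : ℝ) * σ) : ℝ) : EReal) := by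
  simp [scaledPath, WebPath.ofReal, withStar]

/-- Approximation of a path in the closure at two times. Since the starting times of the scaled
paths are discrete, a path which starts at or before `t₀` is approximated by such paths. -/
theorem exists_approx {c : ℤ × ℤ → ℝ} {p σ γ : ℝ} (hγ : 0 < γ) {n : ℕ} (hn : 1 ≤ n) {π : WebPath}
    (hπ : π ∈ pathClosure (scaledPaths c p σ γ n)) {t₀ t x ε δ : ℝ} (ht : 0 < t) (hε : 0 < ε)
    (hδ : 0 < δ) (hs : π.start ≤ (t₀ : EReal)) (hx : π.toFun (t₀ : EReal) = some (x : EReal)) :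
    ∃ u : ℤ × ℤ, (u.2 : ℝ) ≤ (n : ℝ) ^ 2 * γ * t₀ ∧
      x - ε < graphPath c p u ((n : ℝ) ^ 2 * γ * t₀) / ((n : ℝ) * σ) ∧
      graphPath c p u ((n : ℝ) ^ 2 * γ * t₀) / ((n : ℝ) * σ) < x + ε ∧
      |tanhStar (π.toFun ((t₀ + t : ℝ) : EReal)) -
        Real.tanh (graphPath c p u ((n : ℝ) ^ 2 * γ * (t₀ + t)) / ((n : ℝ) * σ))| < δ := by
  have hn0 : (0 : ℝ) < n := by exact_mod_cast hn
  set r : ℝ := (n : ℝ) ^ 2 * γ with hr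
  have hr0 : 0 < r := by positivity
  have hw : ∀ t : ℝ, 0 < weight t := fun t => by rw [weight_coe]; positivity
  -- no scaled path starts in `(t₀, s)`
  set s : ℝ := (⌊r * t₀⌋ + 1) / r with hsdef
  have hs0 : t₀ < s := by
    rw [hsdef, lt_div_iff₀ hr0, mul_comm]
    exact Int.lt_floor_add_one _
  set δ' : ℝ := min (min (δ * weight ((t₀ + t : ℝ) : EReal)) (Real.tanh s - Real.tanh t₀))
    (min ((Real.tanh x - Real.tanh (x - ε)) * weight t₀)
      ((Real.tanh (x + ε) - Real.tanh x) * weight t₀)) with hδ'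
  have hpos : 0 < δ' := by
    refine lt_min (lt_min (mul_pos hδ (hw _)) ?_) (lt_min (mul_pos ?_ (hw _)) (mul_pos ?_ (hw _)))
    · exact sub_pos.2 (strictMono_tanh hs0)
    · exact sub_pos.2 (strictMono_tanh (by linarith))
    · exact sub_pos.2 (strictMono_tanh (by linarith))
  obtain ⟨_, ⟨u, -, rfl⟩, hd⟩ := hπ δ' hpos
  have hd1 := hd.trans_le ((min_le_left _ _).trans (min_le_left _ _))
  have hd2 := hd.trans_le ((min_le_left _ _).trans (min_le_right _ _))
  have hd3 := hd.trans_le ((min_le_right _ _).trans (min_le_left _ _))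
  have hd4 := hd.trans_le ((min_le_right _ _).trans (min_le_right _ _))
  have hstart : (scaledPath c p σ γ n u).start = (((u.2 : ℝ) / r : ℝ) : EReal) := rfl
  have hu : (u.2 : ℝ) ≤ r * t₀ := by
    by_contra hlt
    have h1 : ⌊r * t₀⌋ + 1 ≤ u.2 := by
      have := Int.floor_lt.2 (not_le.1 hlt)
      omega
    have h2 : ((⌊r * t₀⌋ : ℝ) + 1) ≤ u.2 := by exact_mod_cast h1
    have h3 : s ≤ (u.2 : ℝ) / r := by
      rw [hsdef]
      gcongr
    have h4 := strictMono_tanh.monotone h3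
    have h5 := strictMono_tanhE.monotone hs
    rw [tanhE_coe] at h5
    have h6 := (start_le_pathDist π (scaledPath c p σ γ n u)).trans_lt hd2
    rw [hstart, tanhE_coe, abs_sub_comm] at h6
    have := le_abs_self (Real.tanh ((u.2 : ℝ) / r) - tanhE π.start)
    linarith
  have hu' : (scaledPath c p σ γ n u).start ≤ (t₀ : EReal) := by
    rw [hstart, EReal.coe_le_coe_iff, div_le_iff₀ hr0, mul_comm]
    exact hu
  have hlt : (t₀ : EReal) ≤ ((t₀ + t : ℝ) : EReal) := EReal.coe_le_coe_iff.2 (by linarith)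
  have hv0 := value_le_pathDist hs hu'
  have hv1 := value_le_pathDist (hs.trans hlt) (hu'.trans hlt)
  rw [scaledPath_toFun] at hv0 hv1
  simp only [hx, tanhStar, tanhE_coe] at hv0
  rw [show tanhStar (some ((graphPath c p u ((n : ℝ) ^ 2 * γ * (t₀ + t)) / ((n : ℝ) * σ) : ℝ) :
    EReal)) = Real.tanh (graphPath c p u ((n : ℝ) ^ 2 * γ * (t₀ + t)) / ((n : ℝ) * σ)) from
    tanhE_coe _] at hv1
  refine ⟨u, hu, ?_, ?_, ?_⟩
  · have h1 := lt_of_mul_lt_mul_right (hv0.trans_lt hd3) (hw t₀).le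
    have h2 := (le_abs_self _).trans_lt h1
    exact strictMono_tanh.lt_iff_lt.1 (by linarith)
  · have h1 := lt_of_mul_lt_mul_right (hv0.trans_lt hd4) (hw t₀).le
    have h2 := (neg_le_abs _).trans_lt h1
    exact strictMono_tanh.lt_iff_lt.1 (by linarith)
  · exact lt_of_mul_lt_mul_right (hv1.trans_lt hd1) (hw _).le

/-- Two paths of the closure with different positions yield two such paths of the graph. -/
theorem exists_paths_of_two_le_eta {c : ℤ × ℤ → ℝ} {p σ γ : ℝ} (hγ : 0 < γ) {n : ℕ} (hn : 1 ≤ n)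
    {t₀ t a ε : ℝ} (ht : 0 < t) (hε : 0 < ε)
    (h : 2 ≤ eta (pathClosure (scaledPaths c p σ γ n)) t₀ t a (a + ε)) :
    ∃ u v : ℤ × ℤ, (∀ w ∈ ({u, v} : Set (ℤ × ℤ)), (w.2 : ℝ) ≤ (n : ℝ) ^ 2 * γ * t₀ ∧
      a - ε < graphPath c p w ((n : ℝ) ^ 2 * γ * t₀) / ((n : ℝ) * σ) ∧
      graphPath c p w ((n : ℝ) ^ 2 * γ * t₀) / ((n : ℝ) * σ) < a + 2 * ε) ∧
      graphPath c p u ((n : ℝ) ^ 2 * γ * (t₀ + t)) ≠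
        graphPath c p v ((n : ℝ) ^ 2 * γ * (t₀ + t)) := by
  have h1 : 1 < eta (pathClosure (scaledPaths c p σ γ n)) t₀ t a (a + ε) :=
    lt_of_lt_of_le (by norm_num) h
  rw [eta, Set.one_lt_encard_iff] at h1
  obtain ⟨y₁, y₂, ⟨π₁, hπ₁, hs₁, ⟨x₁, hx₁, hv₁⟩, rfl⟩, ⟨π₂, hπ₂, hs₂, ⟨x₂, hx₂, hv₂⟩, rfl⟩,
    hne⟩ := h1
  have hlt : (t₀ : EReal) ≤ ((t₀ + t : ℝ) : EReal) := EReal.coe_le_coe_iff.2 (by linarith)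
  have hsome : ∀ π : WebPath, π.start ≤ (t₀ : EReal) →
      ∃ e, π.toFun ((t₀ + t : ℝ) : EReal) = some e := by
    intro π hs
    refine Option.ne_none_iff_exists'.1 fun h0 => ?_
    have := (π.eq_star_iff _ (hs.trans hlt)).1 h0
    simp only [EReal.coe_ne_top, EReal.coe_ne_bot, or_self] at this
  obtain ⟨e₁, he₁⟩ := hsome π₁ hs₁
  obtain ⟨e₂, he₂⟩ := hsome π₂ hs₂
  have hδ : 0 < |tanhE e₁ - tanhE e₂| / 2 := by
    refine half_pos (abs_pos.2 (sub_ne_zero.2 fun h0 => hne ?_))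
    rw [he₁, he₂, strictMono_tanhE.injective h0]
  obtain ⟨u, hu1, hu2, hu3, hu4⟩ := exists_approx hγ hn hπ₁ ht hε hδ hs₁ hv₁
  obtain ⟨v, hv1, hv2, hv3, hv4⟩ := exists_approx hγ hn hπ₂ ht hε hδ hs₂ hv₂
  refine ⟨u, v, ?_, fun heq => ?_⟩
  · rintro w (rfl | rfl)
    · exact ⟨hu1, by linarith [hx₁.1], by linarith [hx₁.2]⟩
    · exact ⟨hv1, by linarith [hx₂.1], by linarith [hx₂.2]⟩
  · rw [he₁, heq] at hu4
    rw [he₂] at hv4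
    simp only [tanhStar] at hu4 hv4
    have := abs_sub_le (tanhE e₁)
      (Real.tanh (graphPath c p v ((n : ℝ) ^ 2 * γ * (t₀ + t)) / ((n : ℝ) * σ))) (tanhE e₂)
    rw [abs_sub_comm (Real.tanh _) (tanhE e₂)] at this
    linarith

/-! ### Condition (B₁) -/

theorem fieldLaw_window_closed {p : ℝ} (hp0 : 0 < p) (a y : ℤ) (k : ℕ) :
    fieldLaw {c | ∀ z, a - (k + 1) ≤ z → z ≤ a + (k + 1) → p ≤ c (z, y)} ≤
      ENNReal.ofReal (1 - p) ^ k := by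
  have hinj : Function.Injective fun j : ℕ => ((a + j, y) : ℤ × ℤ) := by
    intro i j h
    simpa using congrArg Prod.fst h
  refine (measure_mono ?_).trans ((fieldLaw_forall_le ((Finset.range k).map ⟨_, hinj⟩) hp0).le.trans
    (by simp))
  intro c hc w hw
  simp only [Finset.mem_map, Finset.mem_range, Function.Embedding.coeFn_mk] at hw
  obtain ⟨j, hj, rfl⟩ := hw
  exact hc _ (by omega) (by omega)

/-- The quantitative form of (B₁). Two chains are started in windows of size `k` on either side of
the interval; unless a window is closed, they move to open vertices at the height `⌊n²γt₀⌋`. -/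
theorem fieldLaw_two_le_eta_le {p σ γ : ℝ} (hp0 : 0 < p) (hp1 : p < 1) (hσ : 0 < σ) (hγ : 0 < γ)
    {n : ℕ} (hn : 1 ≤ n) (t₀ a : ℝ) {t ε : ℝ} (ht : 0 < t) (hε : 0 < ε) (k : ℕ) :
    fieldLaw {c | 2 ≤ eta (pathClosure (scaledPaths c p σ γ n)) t₀ t a (a + ε)} ≤
      ENNReal.ofReal (2 * (1 - p) ^ k +
        decayConst p * (3 * (n * σ * ε) + 6 + 2 * k) / (n * √(γ * t))) := by
  have hn0 : (0 : ℝ) < n := by exact_mod_cast hn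
  have hnσ : 0 < (n : ℝ) * σ := by positivity
  set r : ℝ := (n : ℝ) ^ 2 * γ with hr
  have hr0 : 0 < r := by positivity
  set y : ℤ := ⌊r * t₀⌋ with hy
  set h : ℕ := ⌊r * t⌋₊ with hh
  set l : ℝ := n * σ * (a - ε) with hl
  set b : ℝ := n * σ * (a + 2 * ε) with hb
  set i₀ : ℤ := ⌈l⌉ - 3 - k with hi₀
  set j₀ : ℤ := ⌊b⌋ + 3 + k with hj₀
  have hlb : b - l = 3 * (n * σ * ε) := by rw [hl, hb]; ring
  have hij : i₀ < j₀ := by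
    have h1 := Int.ceil_lt_add_one l
    have h2 := Int.lt_floor_add_one b
    have h3 : (0 : ℝ) < n * σ * ε := by positivity
    have h4 : (⌈l⌉ : ℝ) < ⌊b⌋ + 2 := by linarith
    have h5 : ⌈l⌉ < ⌊b⌋ + 2 := by exact_mod_cast h4
    omega
  have hss : Before (i₀, k) (j₀, k) := by
    right
    simp only [sub_self, abs_zero]
    omega
  have hy1 : (y : ℝ) ≤ r * t₀ := Int.floor_le _
  have hy2 : r * t₀ < y + 1 := Int.lt_floor_add_one _
  have hh1 : (h : ℝ) ≤ r * t := Nat.floor_le (by positivity)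
  have hh2 : r * t < h + 1 := Nat.lt_floor_add_one _
  -- the bad event
  have hsub : {c | 2 ≤ eta (pathClosure (scaledPaths c p σ γ n)) t₀ t a (a + ε)} ≤ᵐ[fieldLaw]
      (({c | ∀ z, i₀ - (k + 1) ≤ z → z ≤ i₀ + (k + 1) → p ≤ c (z, y)} ∪
        {c | ∀ z, j₀ - (k + 1) ≤ z → z ≤ j₀ + (k + 1) → p ≤ c (z, y)}) ∪
        {c | chain c p (y - 1) (i₀, k) (1 + h) ≠ chain c p (y - 1) (j₀, k) (1 + h)} :
        Set (ℤ × ℤ → ℝ)) := by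
    filter_upwards [ae_generic hp0] with c hc hcE
    obtain ⟨u, v, huv, hne⟩ := exists_paths_of_two_le_eta hγ hn ht hε hcE
    by_contra hcon
    have hcon1 : ¬ ∀ z, i₀ - (k + 1) ≤ z → z ≤ i₀ + (k + 1) → p ≤ level c y z :=
      fun h => hcon (Or.inl (Or.inl h))
    have hcon2 : ¬ ∀ z, j₀ - (k + 1) ≤ z → z ≤ j₀ + (k + 1) → p ≤ level c y z :=
      fun h => hcon (Or.inl (Or.inr h))
    have hcon3 : chain c p (y - 1) (i₀, k) (1 + h) = chain c p (y - 1) (j₀, k) (1 + h) := by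
      by_contra h; exact hcon (Or.inr h)
    obtain ⟨i, hi, -, hi2, hip, -⟩ := (advance_cases p (level c y) i₀ k).resolve_right
      fun h => hcon1 h.2
    obtain ⟨j, hj, hj1, -, hjp, -⟩ := (advance_cases p (level c y) j₀ k).resolve_right
      fun h => hcon2 h.2
    have hfirst : ∀ s, chain c p (y - 1) s 1 = advance p (level c y) s := by
      intro s
      simp [chain]
    rw [chain_add, chain_add, hfirst, hfirst, hi, hj] at hcon3
    simp only [Nat.cast_one, sub_add_cancel] at hcon3
    have hil : (i : ℝ) + 1 < l := by
      have h1 := Int.ceil_lt_add_one l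
      have h2 : i + 2 ≤ ⌈l⌉ := by omega
      have h3 : (i : ℝ) + 2 ≤ ⌈l⌉ := by exact_mod_cast h2
      linarith
    have hjb : b + 1 < j := by
      have h1 := Int.lt_floor_add_one b
      have h2 : ⌊b⌋ + 2 ≤ j := by omega
      have h3 : (⌊b⌋ : ℝ) + 2 ≤ j := by exact_mod_cast h2
      linarith
    have hend : (y : ℝ) + h ≤ r * (t₀ + t) := by
      rw [mul_add]
      linarith
    have key : ∀ w ∈ ({u, v} : Set (ℤ × ℤ)),
        graphPath c p w (r * (t₀ + t)) = graphPath c p (i, y) (r * (t₀ + t)) := by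
      intro w hw
      obtain ⟨hw1, hw2, hw3⟩ := huv w hw
      rw [lt_div_iff₀ hnσ] at hw2
      rw [div_lt_iff₀ hnσ] at hw3
      refine hc.graphPath_eq_of_sandwich hip hjp hcon3 hy1 hy2 hend hw1 ?_ ?_
      · refine hil.trans ?_
        rw [hl, mul_comm]
        exact hw2
      · refine lt_trans ?_ hjb
        rw [hb, mul_comm ((n : ℝ) * σ)]
        linarith
    exact hne ((key u (by simp)).trans (key v (by simp)).symm)
  refine (measure_mono_ae hsub).trans ((measure_union_le _ _).trans ?_)
  have hp1' : 0 ≤ 1 - p := by linarith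
  have hC := one_le_decayConst hp0 hp1
  have hw : fieldLaw ({c | ∀ z, i₀ - (k + 1) ≤ z → z ≤ i₀ + (k + 1) → p ≤ c (z, y)} ∪
        {c | ∀ z, j₀ - (k + 1) ≤ z → z ≤ j₀ + (k + 1) → p ≤ c (z, y)}) ≤
      ENNReal.ofReal (2 * (1 - p) ^ k) := by
    refine (measure_union_le _ _).trans ((add_le_add (fieldLaw_window_closed hp0 i₀ y k)
      (fieldLaw_window_closed hp0 j₀ y k)).trans ?_)
    rw [← two_mul, ENNReal.ofReal_mul (by norm_num), ENNReal.ofReal_pow hp1']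
    simp
  have hroot : (n : ℝ) * √(γ * t) ≤ √((1 + h : ℕ) : ℝ) := by
    refine Real.le_sqrt_of_sq_le ?_
    rw [mul_pow, Real.sq_sqrt (by positivity)]
    push_cast
    rw [hr] at hh2
    linarith
  have hroot0 : 0 < (n : ℝ) * √(γ * t) := mul_pos hn0 (Real.sqrt_pos.2 (by positivity))
  have hgap : (j₀ : ℝ) - i₀ ≤ 3 * (n * σ * ε) + 6 + 2 * k := by
    have h1 := Int.floor_le b
    have h2 := Int.le_ceil l
    rw [hi₀, hj₀]
    push_cast
    linarith
  have hgap0 : (0 : ℝ) ≤ (j₀ : ℝ) - i₀ := by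
    have : (i₀ : ℝ) < j₀ := by exact_mod_cast hij
    linarith
  have hd : fieldLaw {c | chain c p (y - 1) (i₀, k) (1 + h) ≠ chain c p (y - 1) (j₀, k) (1 + h)} ≤
      ENNReal.ofReal (decayConst p * (3 * (n * σ * ε) + 6 + 2 * k) / (n * √(γ * t))) := by
    rw [← ENNReal.ofReal_toReal (measure_ne_top fieldLaw _)]
    refine ENNReal.ofReal_le_ofReal ((chain_ne_le hp0 hp1 hss (y - 1) (m := 1 + h)
      (by omega)).trans ?_)
    rw [← decayConst]
    have : 0 ≤ decayConst p := by linarith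
    gcongr
  rw [ENNReal.ofReal_add (by positivity) (by positivity)]
  exact add_le_add hw hd

theorem conditionB1_of_isUniformField {p σ γ : ℝ} (hp0 : 0 < p) (hp1 : p < 1) (hσ : 0 < σ)
    (hγ : 0 < γ) {Ω : Type*} [MeasurableSpace Ω] {P : Measure Ω} [IsProbabilityMeasure P]
    {U : ℤ × ℤ → Ω → ℝ} (hU : IsUniformField P U) :
    ConditionB1 P fun n ω => pathClosure (scaledPaths (fun w => U w ω) p σ γ n) := by
  intro t ht
  set R : ℝ := √(γ * t) with hR
  have hR0 : 0 < R := Real.sqrt_pos.2 (by positivity)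
  set C : ℝ := decayConst p * (3 * σ + 2) / R with hC
  have hbound : ∀ ε : ℝ, 0 < ε → limsup (fun n : ℕ => ⨆ q : ℝ × ℝ, P {ω |
      2 ≤ eta (pathClosure (scaledPaths (fun w => U w ω) p σ γ n)) q.2 t q.1 (q.1 + ε)}) atTop ≤
        ENNReal.ofReal ((C + 1) * ε) := by
    intro ε hε
    -- windows of macroscopic size, so that they contain open vertices with high probability
    have hk : Tendsto (fun n : ℕ => ⌊(n : ℝ) * ε⌋₊) atTop atTop :=
      tendsto_nat_floor_atTop.comp (tendsto_natCast_atTop_atTop.atTop_mul_const hε)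
    have h1 : Tendsto (fun n : ℕ => 2 * (1 - p) ^ ⌊(n : ℝ) * ε⌋₊) atTop (𝓝 (2 * 0)) :=
      ((tendsto_pow_atTop_nhds_zero_of_lt_one (by linarith) (by linarith)).comp hk).const_mul 2
    have h2 : Tendsto (fun n : ℕ => decayConst p * 6 / R * (n : ℝ)⁻¹) atTop
        (𝓝 (decayConst p * 6 / R * 0)) :=
      (tendsto_inv_atTop_zero.comp tendsto_natCast_atTop_atTop).const_mul _
    have h3 := h1.add h2
    rw [mul_zero, mul_zero, add_zero] at h3
    have h4 := h3.eventually (gt_mem_nhds hε)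
    refine limsup_le_of_le (by isBoundedDefault) ?_
    filter_upwards [h4, eventually_ge_atTop 1] with n hn hn1
    refine iSup_le fun q => ?_
    refine (hU.le_fieldLaw
      {c | 2 ≤ eta (pathClosure (scaledPaths c p σ γ n)) q.2 t q.1 (q.1 + ε)}).trans
      ((fieldLaw_two_le_eta_le hp0 hp1 hσ hγ hn1 q.2 q.1 ht hε ⌊(n : ℝ) * ε⌋₊).trans
      (ENNReal.ofReal_le_ofReal ?_))
    have hn0 : (0 : ℝ) < n := by exact_mod_cast hn1
    have hfl : (⌊(n : ℝ) * ε⌋₊ : ℝ) ≤ n * ε := Nat.floor_le (by positivity)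
    have hd : 0 ≤ decayConst p := by linarith [one_le_decayConst hp0 hp1]
    have h5 : decayConst p * (3 * (n * σ * ε) + 6 + 2 * (⌊(n : ℝ) * ε⌋₊ : ℝ)) / (n * R) ≤
        C * ε + decayConst p * 6 / R * (n : ℝ)⁻¹ := by
      calc decayConst p * (3 * (n * σ * ε) + 6 + 2 * (⌊(n : ℝ) * ε⌋₊ : ℝ)) / (n * R)
          ≤ decayConst p * (3 * (n * σ * ε) + 6 + 2 * (n * ε)) / (n * R) := by gcongr
        _ = C * ε + decayConst p * 6 / R * (n : ℝ)⁻¹ := by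
            rw [hC]
            field_simp
            ring
    linarith
  have hlim : Tendsto (fun ε : ℝ => ENNReal.ofReal ((C + 1) * ε)) (𝓝[>] 0) (𝓝 0) := by
    have h : Continuous fun ε : ℝ => ENNReal.ofReal ((C + 1) * ε) :=
      ENNReal.continuous_ofReal.comp (by fun_prop)
    have h0 := h.tendsto 0
    rw [mul_zero, ENNReal.ofReal_zero] at h0
    exact h0.mono_left nhdsWithin_le_nhds
  refine tendsto_of_tendsto_of_tendsto_of_le_of_le' tendsto_const_nhds hlim
    (Eventually.of_forall fun _ => zero_le) ?_
  filter_upwards [self_mem_nhdsWithin] with ε hε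
  exact hbound ε hε

end Drainage

theorem proposition4p6 (p : ℝ) (hp0 : 0 < p) (hp1 : p < 1) :
    ∃ C₁ C₂ : ℝ, 0 < C₁ ∧ 0 < C₂ ∧
      ∀ (Ω : Type*) [MeasurableSpace Ω] (P : Measure Ω) [IsProbabilityMeasure P]
        (U : ℤ × ℤ → Ω → ℝ), Drainage.IsUniformField P U →
        (∀ (x : ℕ) (t : ℝ), 1 ≤ x → 0 < t →
          P {ω | ENNReal.ofReal t <
              ((Drainage.coalSteps (fun w => U w ω) p ((x : ℤ), 0) (0, 0) : ℕ∞) : ℝ≥0∞)} ≤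
            ENNReal.ofReal (C₁ * x / √t)) ∧
        (∀ (x : ℕ) (t : ℝ), 1 ≤ x → 0 < t →
          P {ω | (t : EReal) ≤ Drainage.coalHeight (fun w => U w ω) p ((x : ℤ), 0) (0, 0)} ≤
            ENNReal.ofReal (C₂ * x / √t)) ∧
        (∀ σ γ : ℝ, 0 < σ → 0 < γ →
          Drainage.ConditionB1 P fun n ω =>
            Drainage.pathClosure (Drainage.scaledPaths (fun w => U w ω) p σ γ n)) := by
  have hC := Drainage.one_le_decayConst hp0 hp1
  refine ⟨2 * Drainage.decayConst p, 2 * Drainage.decayConst p, by linarith, by linarith, ?_⟩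
  intro Ω _ P _ U hU
  refine ⟨fun x t hx ht => ?_, fun x t hx ht => ?_, fun σ γ hσ hγ =>
    Drainage.conditionB1_of_isUniformField hp0 hp1 hσ hγ hU⟩
  · exact (hU.le_fieldLaw {c | ENNReal.ofReal t <
      ((Drainage.coalSteps c p ((x : ℤ), 0) (0, 0) : ℕ∞) : ℝ≥0∞)}).trans
      ((measure_mono fun c hc => Or.inl hc).trans (Drainage.fieldLaw_coal_le hp0 hp1 hx ht))
  · exact (hU.le_fieldLaw {c | (t : EReal) ≤ Drainage.coalHeight c p ((x : ℤ), 0) (0, 0)}).trans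
      ((measure_mono fun c hc => Or.inr hc).trans (Drainage.fieldLaw_coal_le hp0 hp1 hx ht))
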